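/- Conventions. In a bicategory $\mathcal B$, 1-cells compose as $gf$, $\simeq$ denotes an invertible 2-cell, associators are suppressed, and $\mathcal B^{\mathrm{op}}$ reverses only 1-cells. A bicategory is *filtered* if it is non-empty and every finite diagram in it (a pseudo-functor $F$ from a bicategory with finitely many objects, arrows and 2-cells) has a pseudo-cocone, i.e. a pseudo-natural transformation from $F$ to a constant diagram; it is *cofiltered* if its opposite is filtered. Let $\mathcal B$ be a bicategory, $\mathcal W$ a family of arrows of $\mathcal B$ (no closure property is needed), and $A,B$ objects of $\mathcal B$. Let $\mathcal W/A$ be the bicategory with objects the pairs $(C,w)$, $w\colon C\to A$ in $\mathcal W$; arrows $(C_1,w_1)\to(C_2,w_2)$ the pairs $(f,\alpha)$ with $f\colon C_1\to C_2$ and $\alpha\colon w_1\simeq w_2f$; and 2-cells $(f_1,\alpha_1)\Rightarrow(f_2,\alpha_2)$ the 2-cells $\xi\colon f_1\Rightarrow f_2$ of $\mathcal B$ with $(w_2\star\xi)\circ\alpha_1=\alpha_2$. Let $U\colon\mathcal W/A\to\mathcal B$ be the forgetful pseudo-functor and $$F=F_A^B\colon(\mathcal W/A)^{\mathrm{op}}\xrightarrow{U}\mathcal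 B^{\mathrm{op}}\xrightarrow{\mathcal B(-,B)}\mathbf{Cat}.$$ *The category $\operatorname{Colim}F$* (for a pseudo-functor $F\colon\mathcal J\to\mathbf{Cat}$ with constraints $F^2_{g,f}\colon Fg\circ Ff\simeq F(gf)$). Objects: pairs $(J,x)$, $J\in\mathcal J$, $x\in FJ$. Premorphisms $(J,x)\to(J',y)$: quadruples $(K,u,v,\xi)$ with $u\colon J\to K$, $v\colon J'\to K$ and $\xi\colon Fu(x)\to Fv(y)$ in $FK$. Two premorphisms $(K_i,u_i,v_i,\xi_i)$, $i=1,2$, are homotopic if there are $w_i\colon K_i\to L$, $\alpha\colon w_1u_1\simeq w_2u_2$ and $\beta\colon w_1v_1\simeq w_2v_2$ with $$Fw_2(\xi_2)\circ(F^2_{w_2,u_2})^{-1}_x\circ(F\alpha)_x\circ(F^2_{w_1,u_1})_x=(F^2_{w_2,v_2})^{-1}_y\circ(F\beta)_y\circ(F^2_{w_1,v_1})_y\circ Fw_1(\xi_1).$$ Arrows: homotopy classes of premorphisms. Identities: $[(J,1_J,1_J,1)]$. Composition: for $(K_1,u_1,v_1,\xi_1)\colon(J,x)\to(J',y)$ and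 $(K_2,u_2,v_2,\xi_2)\colon(J',y)\to(J'',z)$ and any square $f\colon K_1\to L$, $g\colon K_2\to L$, $\gamma\colon fv_1\simeq gu_2$, $$[(K_2,u_2,v_2,\xi_2)]\circ[(K_1,u_1,v_1,\xi_1)]=[(L,fu_1,gv_2,\;\widehat{g\xi_2}\circ(F\gamma)_y\circ\widehat{f\xi_1})],$$ where $\widehat{f\xi_1}=(F^2_{f,v_1})_y\circ Ff(\xi_1)\circ(F^2_{f,u_1})^{-1}_x$ and $\widehat{g\xi_2}=(F^2_{g,v_2})_z\circ Fg(\xi_2)\circ(F^2_{g,u_2})^{-1}_y$. *The category $\mathcal B[\mathcal W^{-1}](A,B)$.* Objects: triples $(C,w,f)$ with $w\colon C\to A$ in $\mathcal W$ and $f\colon C\to B$. Arrows $(C_1,w_1,f_1)\to(C_2,w_2,f_2)$: classes of quintuples $(C,u,v,\alpha,\xi)$ with $u\colon C\to C_1$, $v\colon C\to C_2$, $\alpha\colon w_1u\simeq w_2v$, $\xi\colon f_1u\Rightarrow f_2v$, such that $w_1u$ is isomorphic to an arrow of $\mathcal W$. Two quintuples $(C,u,v,\alpha,\xi)$, $(\tilde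 C,\tilde u,\tilde v,\tilde\alpha,\tilde\xi)$ are homotopic if there are $h\colon\bar C\to C$, $\tilde h\colon\bar C\to\tilde C$, $\gamma\colon uh\simeq\tilde u\tilde h$, $\delta\colon vh\simeq\tilde v\tilde h$ with $w_1uh$ isomorphic to an arrow of $\mathcal W$ and $$(\tilde\alpha\star\tilde h)\circ(w_1\star\gamma)=(w_2\star\delta)\circ(\alpha\star h),\qquad(\tilde\xi\star\tilde h)\circ(f_1\star\gamma)=(f_2\star\delta)\circ(\xi\star h).$$ Identities: $[(C,1_C,1_C,1,1)]$. Composition (vertical composition of 2-cells in the bicategory of fractions): for $(C,u,v,\alpha,\xi)\colon(C_1,w_1,f_1)\to(C_2,w_2,f_2)$ and $(C',u',v',\alpha',\xi')\colon(C_2,w_2,f_2)\to(C_3,w_3,f_3)$, choose a square $h\colon D\to C$, $g\colon D\to C'$, $\gamma\colon vh\simeq u'g$ with $w_1uh$ isomorphic to an arrow of $\mathcal W$; the composite is the class of $$(D,\;uh,\;v'g,\;(\alpha'\star g)\circ(w_2\star\gamma)\circ(\alpha\star h),\;(\xi'\star g)\circ(f_2\star\gamma)\circ(\xi\star h)).$$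 **Proposition.** Suppose that $\mathcal W/A$ is cofiltered. Then: 1. for $F=F_A^B$ and for $\mathcal B[\mathcal W^{-1}](A,B)$, homotopy is an equivalence relation, any two composable representatives admit a square as above, and the formulas define categories $\operatorname{Colim}F_A^B$ and $\mathcal B[\mathcal W^{-1}](A,B)$, the composite being independent of the representatives and of the square; 2. $\operatorname{Colim}F_A^B$ is the pseudo-colimit of $F_A^B$: there is a pseudo-cocone on $F_A^B$ with apex $\operatorname{Colim}F_A^B$, sending $x\in F_A^B(J)$ to $(J,x)$, such that for every category $\mathbf E$ composition with it is an isomorphism from the category of functors $\operatorname{Colim}F_A^B\to\mathbf E$ to the category of pseudo-cocones on $F_A^B$ with apex $\mathbf E$ and modifications; 3. the assignment $((C,w),f)\mapsto(C,w,f)$, $[((C,w),(u,\alpha_u),(v,\alpha_v),\xi)]\mapsto[(C,u,v,\alpha_v\alpha_u^{-1},\xi)]$ is an isomorphism of categories $\operatorname{Colim}F_A^B\cong\mathcal B[\mathcal W^{-1}](A,B)$. In particular, the vertical composition in $\mathcal B[\mathcal W^{-1}](A,B)$ is independent of the choice of squares. -/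

import Mathlib

open CategoryTheory Bicategory Opposite

universe vE uE w v u w' v' u' v₁ u₁

namespace BicatFrac

/-! ### Filtered and cofiltered bicategories -/

section Filtered

variable {C : Type u'} [Bicategory.{w', v'} C] {J : Type u} [Bicategory.{w, v} J]

/-- A pseudo-cocone with apex `E` on a diagram `F` in a bicategory: arrows `θ_A : F A ⟶ E` and
invertible 2-cells `θ_f : θ_B ∘ F f ≅ θ_A`, subject to the unity, functoriality and vertical
naturality axioms. -/
structure PseudoCocone (F : C ⥤ᵖ J) (E : J) where
  leg (a : C) : F.obj a ⟶ E
  iso {a b : C} (f : a ⟶ b) : F.map f ≫ leg b ≅ leg a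
  unity (a : C) : (iso (𝟙 a)).hom = (F.mapId a).hom ▷ leg a ≫ (λ_ (leg a)).hom
  functoriality {a b c : C} (f : a ⟶ b) (g : b ⟶ c) :
    (iso (f ≫ g)).hom = (F.mapComp f g).hom ▷ leg c ≫ (α_ (F.map f) (F.map g) (leg c)).hom ≫
      F.map f ◁ (iso g).hom ≫ (iso f).hom
  naturality {a b : C} {f g : a ⟶ b} (η : f ⟶ g) :
    F.map₂ η ▷ leg b ≫ (iso g).hom = (iso f).hom

/-- A non-empty bicategory is filtered if every finite diagram in it (indexed by a bicategory with
finitely many objects, arrows and 2-cells) has a pseudo-cocone. -/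
def IsFilteredBicat (J : Type u) [Bicategory.{w, v} J] : Prop :=
  Nonempty J ∧
    ∀ (C : Type) [Bicategory.{0, 0} C], Finite C → (∀ a b : C, Finite (a ⟶ b)) →
      (∀ (a b : C) (f g : a ⟶ b), Finite (f ⟶ g)) →
        ∀ F : C ⥤ᵖ J, ∃ E : J, Nonempty (PseudoCocone F E)

/-- A bicategory is cofiltered if its opposite (reversing only 1-cells) is filtered. -/
def IsCofilteredBicat (J : Type u) [Bicategory.{w, v} J] : Prop :=
  IsFilteredBicat Jᵒᵖ

end Filtered

/-! ### Pseudo-colimits of categories indexed by a bicategory -/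

section Cat

variable {J : Type u₁} [Bicategory.{w', v₁} J] (F : J ⥤ᵖ Cat.{v', u'})

/-- A pseudo-cocone on a `Cat`-valued diagram `F`, with apex a category `E` of any size, that is,
a pseudo-natural transformation from `F` to the constant diagram at `E`. -/
structure CatCocone (E : Type uE) [Category.{vE} E] where
  leg (j : J) : F.obj j ⥤ E
  iso {i j : J} (a : i ⟶ j) : (F.map a).toFunctor ⋙ leg j ≅ leg i
  unity (i : J) (x : F.obj i) :
    (iso (𝟙 i)).hom.app x = (leg i).map ((F.mapId i).hom.toNatTrans.app x)
  functoriality {i j k : J} (a : i ⟶ j) (b : j ⟶ k) (x : F.obj i) :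
    (iso (a ≫ b)).hom.app x = (leg k).map ((F.mapComp a b).hom.toNatTrans.app x) ≫
      (iso b).hom.app ((F.map a).toFunctor.obj x) ≫ (iso a).hom.app x
  naturality {i j : J} {a b : i ⟶ j} (η : a ⟶ b) (x : F.obj i) :
    (leg j).map ((F.map₂ η).toNatTrans.app x) ≫ (iso b).hom.app x = (iso a).hom.app x

namespace CatCocone

variable {F} {E : Type uE} [Category.{vE} E]

/-- A morphism of pseudo-cocones with the same apex is a modification. -/
@[ext]
structure Hom (θ θ' : CatCocone F E) where
  app (j : J) : θ.leg j ⟶ θ'.leg j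
  comm {i j : J} (a : i ⟶ j) (x : F.obj i) :
    (θ.iso a).hom.app x ≫ (app i).app x =
      (app j).app ((F.map a).toFunctor.obj x) ≫ (θ'.iso a).hom.app x

instance : Category (CatCocone F E) where
  Hom := Hom
  id θ := { app := fun j => 𝟙 (θ.leg j), comm := by intros; simp }
  comp s t :=
    { app := fun j => s.app j ≫ t.app j
      comm := fun {i j} a x => by
        rw [NatTrans.comp_app, NatTrans.comp_app, ← Category.assoc, s.comm, Category.assoc, t.comm,
          Category.assoc] }
  id_comp s := by apply Hom.ext; funext j; exact Category.id_comp _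
  comp_id s := by apply Hom.ext; funext j; exact Category.comp_id _
  assoc s t r := by apply Hom.ext; funext j; exact Category.assoc _ _ _

variable {L : Type u} [Category.{v} L]

/-- Postcomposition of a pseudo-cocone with a functor out of its apex. -/
def push (θ : CatCocone F L) (G : L ⥤ E) : CatCocone F E where
  leg j := θ.leg j ⋙ G
  iso {i j} a := (Functor.associator _ _ _).symm ≪≫ Functor.isoWhiskerRight (θ.iso a) G
  unity i x := by
    change 𝟙 _ ≫ G.map ((θ.iso (𝟙 i)).hom.app x) = G.map ((θ.leg i).map _)
    rw [θ.unity, Category.id_comp]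
  functoriality {i j k} a b x := by
    change 𝟙 _ ≫ G.map ((θ.iso (a ≫ b)).hom.app x) = G.map ((θ.leg k).map _) ≫
      (𝟙 _ ≫ G.map ((θ.iso b).hom.app _)) ≫ (𝟙 _ ≫ G.map ((θ.iso a).hom.app x))
    rw [θ.functoriality]
    simp only [Category.id_comp, G.map_comp]
  naturality {i j a b} η x := by
    change G.map ((θ.leg j).map _) ≫ (𝟙 _ ≫ G.map ((θ.iso b).hom.app x)) =
      𝟙 _ ≫ G.map ((θ.iso a).hom.app x)
    rw [← θ.naturality η x]
    simp only [Category.id_comp, G.map_comp]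

/-- Postcomposition with a pseudo-cocone, as a functor from functors to pseudo-cocones. -/
def pushFunctor (θ : CatCocone F L) (E : Type uE) [Category.{vE} E] :
    (L ⥤ E) ⥤ CatCocone F E where
  obj G := θ.push G
  map t :=
    { app := fun j => Functor.whiskerLeft (θ.leg j) t
      comm := fun a x => by simp [push] }
  map_id G := by apply Hom.ext; funext j; ext x; rfl
  map_comp s t := by apply Hom.ext; funext j; ext x; rfl

end CatCocone

/-- A functor is an isomorphism of categories if it is bijective on objects and on arrows. -/
def IsIsoOfCategories {C : Type u} [Category.{v} C] {D : Type u'} [Category.{v'} D]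
    (Φ : C ⥤ D) : Prop :=
  Function.Bijective Φ.obj ∧
    ∀ X Y : C, Function.Bijective (fun f : X ⟶ Y => Φ.map f)

/-- A pseudo-cocone exhibits its apex `L` as the pseudo-colimit of `F` (in the strict sense) if for
every category `E`, postcomposition is an isomorphism from the category of functors `L ⥤ E` to the
category of pseudo-cocones with apex `E`. -/
def CatCocone.IsPseudoColimit {F : J ⥤ᵖ Cat.{v', u'}} {L : Type u} [Category.{v} L]
    (θ : CatCocone F L) : Prop :=
  ∀ (E : Type uE) [Category.{vE} E], IsIsoOfCategories (θ.pushFunctor E)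

/-! ### The explicit formula for filtered pseudo-colimits of categories -/

/-- Objects of the pseudo-colimit: pairs `(A, x)` with `x` an object of `F A`. -/
structure ColimObj where
  base : J
  pt : F.obj base

variable {F}

/-- Premorphisms `(C, u, v, ξ) : (A, x) → (B, y)`. -/
structure ColimPre (X Y : ColimObj F) where
  apex : J
  u : X.base ⟶ apex
  v : Y.base ⟶ apex
  ξ : (F.map u).toFunctor.obj X.pt ⟶ (F.map v).toFunctor.obj Y.pt

namespace ColimPre

variable {X Y Z : ColimObj F}

/-- For `ξ : F u x ⟶ F v y` and `k`, the composite
`F (k u) x ⟶ F k (F u x) ⟶ F k (F v y) ⟶ F (k v) y`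
of `F k ξ` with the functoriality constraints. -/
def hat {a b c d : J} (u : a ⟶ c) (v : b ⟶ c) (k : c ⟶ d) {x : F.obj a} {y : F.obj b}
    (ξ : (F.map u).toFunctor.obj x ⟶ (F.map v).toFunctor.obj y) :
    (F.map (u ≫ k)).toFunctor.obj x ⟶ (F.map (v ≫ k)).toFunctor.obj y :=
  (F.mapComp u k).hom.toNatTrans.app x ≫ (F.map k).toFunctor.map ξ ≫
    (F.mapComp v k).inv.toNatTrans.app y

/-- Homotopies `(C, w₁, w₂, α, β) : (C₁, u₁, v₁, ξ₁) ≡ (C₂, u₂, v₂, ξ₂)`. -/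
structure Homotopy (p q : ColimPre X Y) where
  apex : J
  w₁ : p.apex ⟶ apex
  w₂ : q.apex ⟶ apex
  α : p.u ≫ w₁ ≅ q.u ≫ w₂
  β : p.v ≫ w₁ ≅ q.v ≫ w₂
  comm :
    (F.mapComp p.u w₁).inv.toNatTrans.app X.pt ≫ (F.map₂ α.hom).toNatTrans.app X.pt ≫
        (F.mapComp q.u w₂).hom.toNatTrans.app X.pt ≫ (F.map w₂).toFunctor.map q.ξ =
      (F.map w₁).toFunctor.map p.ξ ≫ (F.mapComp p.v w₁).inv.toNatTrans.app Y.pt ≫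
        (F.map₂ β.hom).toNatTrans.app Y.pt ≫ (F.mapComp q.v w₂).hom.toNatTrans.app Y.pt

/-- Two premorphisms are homotopic if there is a homotopy between them. -/
def Homotopic (p q : ColimPre X Y) : Prop := Nonempty (Homotopy p q)

variable (X) in
/-- The premorphism `(A, 1_A, 1_A, 1)` representing the identity of `(A, x)`. -/
def id : ColimPre X X where
  apex := X.base
  u := 𝟙 X.base
  v := 𝟙 X.base
  ξ := 𝟙 _

/-- The squares `(D, f, g, γ)`, with `γ : f v₁ ≅ g u₂`, that may be used to compose two
premorphisms. -/
structure Square (p : ColimPre X Y) (q : ColimPre Y Z) where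
  apex : J
  f : p.apex ⟶ apex
  g : q.apex ⟶ apex
  γ : p.v ≫ f ≅ q.u ≫ g

/-- The composite of two premorphisms along a square. -/
def comp (p : ColimPre X Y) (q : ColimPre Y Z) (s : Square p q) : ColimPre X Z where
  apex := s.apex
  u := p.u ≫ s.f
  v := q.v ≫ s.g
  ξ := hat p.u p.v s.f p.ξ ≫ (F.map₂ s.γ.hom).toNatTrans.app Y.pt ≫ hat q.u q.v s.g q.ξ

end ColimPre

/-- Arrows of the pseudo-colimit: premorphisms modulo homotopy. -/
def ColimHom (X Y : ColimObj F) := Quot (ColimPre.Homotopic (X := X) (Y := Y))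

/-- The class of a premorphism. -/
def ColimHom.mk {X Y : ColimObj F} (p : ColimPre X Y) : ColimHom X Y := Quot.mk _ p

variable (F) in
/-- A category structure on the objects `ColimObj F` and the arrows `ColimHom`, whose identities are
the classes of the identity premorphisms, and in which the composite of two classes is computed by
*every* choice of representatives and of a square. -/
structure ColimCategory where
  comp {X Y Z : ColimObj F} : ColimHom X Y → ColimHom Y Z → ColimHom X Z
  comp_mk {X Y Z : ColimObj F} (p : ColimPre X Y) (q : ColimPre Y Z) (s : p.Square q) :
    comp (ColimHom.mk p) (ColimHom.mk q) = ColimHom.mk (p.comp q s)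
  id_comp {X Y : ColimObj F} (f : ColimHom X Y) : comp (ColimHom.mk (ColimPre.id X)) f = f
  comp_id {X Y : ColimObj F} (f : ColimHom X Y) : comp f (ColimHom.mk (ColimPre.id Y)) = f
  assoc {X Y Z T : ColimObj F} (f : ColimHom X Y) (g : ColimHom Y Z) (h : ColimHom Z T) :
    comp (comp f g) h = comp f (comp g h)

/-- The category `Colim F`, as a type of objects. -/
def ColimCategory.Carrier (_ : ColimCategory F) := ColimObj F

instance (S : ColimCategory F) : Category S.Carrier where
  Hom X Y := ColimHom (F := F) X Y
  id X := ColimHom.mk (ColimPre.id (F := F) X)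
  comp f g := S.comp f g
  id_comp f := S.id_comp f
  comp_id f := S.comp_id f
  assoc f g h := S.assoc f g h

end Cat

/-! ### The slice bicategory of a family of arrows -/

section Slice

variable {B : Type u} [Bicategory.{w, v} B]

/-- Objects of `𝓦/A`: pairs `(C, w)` with `w : C ⟶ A` in the family `W`. -/
structure WSlice (W : ∀ ⦃X Y : B⦄, (X ⟶ Y) → Prop) (A : B) where
  dom : B
  arr : dom ⟶ A
  mem : W arr

namespace WSlice

variable {W : ∀ ⦃X Y : B⦄, (X ⟶ Y) → Prop} {A : B}

/-- Arrows of `𝓦/A`: pairs `(f, α)` with `α : w₁ ⟹ w₂ f` an invertible 2-cell. -/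
structure Hom (X Y : WSlice W A) where
  hom : X.dom ⟶ Y.dom
  iso : X.arr ≅ hom ≫ Y.arr

/-- 2-cells of `𝓦/A`: 2-cells `ξ : f₁ ⟹ f₂` with `(w₂ ⋆ ξ) α₁ = α₂`. -/
@[ext]
structure Hom₂ {X Y : WSlice W A} (f g : Hom X Y) where
  cell : f.hom ⟶ g.hom
  comm : f.iso.hom ≫ cell ▷ Y.arr = g.iso.hom

instance : CategoryStruct (WSlice W A) where
  Hom := Hom
  id X := ⟨𝟙 X.dom, (λ_ X.arr).symm⟩
  comp f g := ⟨f.hom ≫ g.hom,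
    f.iso ≪≫ whiskerLeftIso f.hom g.iso ≪≫ (α_ f.hom g.hom _).symm⟩

instance homCat (X Y : WSlice W A) : Category (X ⟶ Y) where
  Hom f g := Hom₂ f g
  id f := ⟨𝟙 f.hom, by simp⟩
  comp s t := ⟨s.cell ≫ t.cell, by rw [comp_whiskerRight, ← Category.assoc, s.comm, t.comm]⟩
  id_comp s := by apply Hom₂.ext; exact Category.id_comp _
  comp_id s := by apply Hom₂.ext; exact Category.comp_id _
  assoc s t r := by apply Hom₂.ext; exact Category.assoc _ _ _

/-- An invertible 2-cell of `B` satisfying the equation of 2-cells is invertible in the slice. -/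
def isoMk {X Y : WSlice W A} {f g : X ⟶ Y} (e : f.hom ≅ g.hom)
    (h : f.iso.hom ≫ e.hom ▷ Y.arr = g.iso.hom) : f ≅ g where
  hom := ⟨e.hom, h⟩
  inv := ⟨e.inv, by rw [← h, Category.assoc, ← comp_whiskerRight]; simp⟩
  hom_inv_id := by apply Hom₂.ext; exact e.hom_inv_id
  inv_hom_id := by apply Hom₂.ext; exact e.inv_hom_id

theorem hom₂_ext {X Y : WSlice W A} {f g : X ⟶ Y} {s t : f ⟶ g} (h : s.cell = t.cell) : s = t :=
  Hom₂.ext h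

/-- The bicategory `𝓦/A`. -/
instance : Bicategory (WSlice W A) where
  homCategory := homCat
  whiskerLeft {X Y Z} f {g h} η := ⟨f.hom ◁ η.cell, by
    change (f.iso ≪≫ whiskerLeftIso f.hom g.iso ≪≫ (α_ f.hom g.hom Z.arr).symm).hom ≫ _ =
      (f.iso ≪≫ whiskerLeftIso f.hom h.iso ≪≫ (α_ f.hom h.hom Z.arr).symm).hom
    simp [← η.comm]⟩
  whiskerRight {X Y Z} {f g} η h := ⟨η.cell ▷ h.hom, by
    change (f.iso ≪≫ whiskerLeftIso f.hom h.iso ≪≫ (α_ f.hom h.hom Z.arr).symm).hom ≫ _ =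
      (g.iso ≪≫ whiskerLeftIso g.hom h.iso ≪≫ (α_ g.hom h.hom Z.arr).symm).hom
    simp [← η.comm, ← whisker_exchange_assoc]⟩
  associator {X Y Z T} f g h := isoMk (α_ f.hom g.hom h.hom) (by
    change ((f.iso ≪≫ whiskerLeftIso f.hom g.iso ≪≫ (α_ f.hom g.hom Z.arr).symm) ≪≫
        whiskerLeftIso (f.hom ≫ g.hom) h.iso ≪≫ (α_ (f.hom ≫ g.hom) h.hom T.arr).symm).hom ≫ _ =
      (f.iso ≪≫ whiskerLeftIso f.hom (g.iso ≪≫ whiskerLeftIso g.hom h.iso ≪≫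
        (α_ g.hom h.hom T.arr).symm) ≪≫ (α_ f.hom (g.hom ≫ h.hom) T.arr).symm).hom
    simp)
  leftUnitor {X Y} f := isoMk (λ_ f.hom) (by
    change ((λ_ X.arr).symm ≪≫ whiskerLeftIso (𝟙 X.dom) f.iso ≪≫
      (α_ (𝟙 X.dom) f.hom Y.arr).symm).hom ≫ _ = f.iso.hom
    simp)
  rightUnitor {X Y} f := isoMk (ρ_ f.hom) (by
    change (f.iso ≪≫ whiskerLeftIso f.hom (λ_ Y.arr).symm ≪≫
      (α_ f.hom (𝟙 Y.dom) Y.arr).symm).hom ≫ _ = f.iso.hom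
    simp)
  whiskerLeft_id f g := hom₂_ext (whiskerLeft_id f.hom g.hom)
  whiskerLeft_comp f _ _ _ η θ := hom₂_ext (whiskerLeft_comp f.hom η.cell θ.cell)
  id_whiskerLeft η := hom₂_ext (id_whiskerLeft η.cell)
  comp_whiskerLeft f g _ _ η := hom₂_ext (comp_whiskerLeft f.hom g.hom η.cell)
  id_whiskerRight f g := hom₂_ext (id_whiskerRight f.hom g.hom)
  comp_whiskerRight η θ i := hom₂_ext (comp_whiskerRight η.cell θ.cell i.hom)
  whiskerRight_id η := hom₂_ext (whiskerRight_id η.cell)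
  whiskerRight_comp η g h := hom₂_ext (whiskerRight_comp η.cell g.hom h.hom)
  whisker_assoc f _ _ η h := hom₂_ext (whisker_assoc f.hom η.cell h.hom)
  whisker_exchange η θ := hom₂_ext (whisker_exchange η.cell θ.cell)
  pentagon f g h i := hom₂_ext (pentagon f.hom g.hom h.hom i.hom)
  triangle f g := hom₂_ext (triangle f.hom g.hom)

variable (W A) in
/-- The forgetful pseudo-functor `U : 𝓦/A ⥤ B`. It is strict. -/
def forget : WSlice W A ⥤ᵖ B where
  obj X := X.dom
  map f := f.hom
  map₂ η := η.cell
  map₂_id _ := rfl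
  map₂_comp _ _ := rfl
  mapId X := Iso.refl (𝟙 X.dom)
  mapComp f g := Iso.refl (f.hom ≫ g.hom)
  map₂_whisker_left f _ _ η := by
    change f.hom ◁ η.cell = 𝟙 _ ≫ f.hom ◁ η.cell ≫ 𝟙 _
    simp
  map₂_whisker_right η h := by
    change η.cell ▷ h.hom = 𝟙 _ ≫ η.cell ▷ h.hom ≫ 𝟙 _
    simp
  map₂_associator f g h := by
    change (α_ f.hom g.hom h.hom).hom = 𝟙 _ ≫ 𝟙 (f.hom ≫ g.hom) ▷ h.hom ≫
      (α_ f.hom g.hom h.hom).hom ≫ f.hom ◁ 𝟙 (g.hom ≫ h.hom) ≫ 𝟙 _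
    simp
  map₂_left_unitor {X Y} f := by
    change (λ_ f.hom).hom = 𝟙 _ ≫ 𝟙 (𝟙 X.dom) ▷ f.hom ≫ (λ_ f.hom).hom
    simp
  map₂_right_unitor {X Y} f := by
    change (ρ_ f.hom).hom = 𝟙 _ ≫ f.hom ◁ 𝟙 (𝟙 Y.dom) ≫ (ρ_ f.hom).hom
    simp

end WSlice

end Slice

/-! ### The diagram of hom-categories -/

section Diagram

variable {B : Type u} [Bicategory.{w, v} B]

/-- A pseudo-functor `F : B ⥤ C` induces a pseudo-functor `Bᵒᵖ ⥤ Cᵒᵖ`. -/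
def opPseudofunctor {C : Type u'} [Bicategory.{w', v'} C] (F : B ⥤ᵖ C) : Bᵒᵖ ⥤ᵖ Cᵒᵖ where
  obj X := op (F.obj X.unop)
  map f := (F.map f.unop).op
  map₂ η := Bicategory.Opposite.op2 (F.map₂ η.unop2)
  map₂_id f := congrArg Bicategory.Opposite.op2 (F.map₂_id f.unop)
  map₂_comp η θ := congrArg Bicategory.Opposite.op2 (F.map₂_comp η.unop2 θ.unop2)
  mapId X := (F.mapId X.unop).op2
  mapComp f g := (F.mapComp g.unop f.unop).op2
  map₂_whisker_left f _ _ η :=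
    congrArg Bicategory.Opposite.op2 (F.map₂_whisker_right η.unop2 f.unop)
  map₂_whisker_right η h :=
    congrArg Bicategory.Opposite.op2 (F.map₂_whisker_left h.unop η.unop2)
  map₂_associator f g h := congrArg Bicategory.Opposite.op2 (by
    change F.map₂ (α_ h.unop g.unop f.unop).inv =
      (F.mapComp h.unop (g.unop ≫ f.unop)).hom ≫ F.map h.unop ◁ (F.mapComp g.unop f.unop).hom ≫
        (α_ (F.map h.unop) (F.map g.unop) (F.map f.unop)).inv ≫
          (F.mapComp h.unop g.unop).inv ▷ F.map f.unop ≫ (F.mapComp (h.unop ≫ g.unop) f.unop).inv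
    rw [F.mapComp_assoc_right_hom_assoc]
    simp)
  map₂_left_unitor f := congrArg Bicategory.Opposite.op2 (F.map₂_right_unitor f.unop)
  map₂_right_unitor f := congrArg Bicategory.Opposite.op2 (F.map₂_left_unitor f.unop)

/-- The pseudo-functor `F_A^B : (𝓦/A)ᵒᵖ ⥤ Bᵒᵖ ⥤ Cat`, the composite of the forgetful pseudo-functor
and of the representable pseudo-functor `𝓑(-, T)`. -/
def homDiagram (W : ∀ ⦃X Y : B⦄, (X ⟶ Y) → Prop) (A T : B) : (WSlice W A)ᵒᵖ ⥤ᵖ Cat.{w, v} :=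
  (opPseudofunctor (WSlice.forget W A)).comp (Bicategory.yoneda₀ T)

end Diagram

/-! ### The hom-categories of the bicategory of fractions -/

section Frac

variable {B : Type u} [Bicategory.{w, v} B]

/-- Objects of `𝓑[𝓦⁻¹](A, T)`: triples `(C, w, f)` with `w : C ⟶ A` in `W` and `f : C ⟶ T`. -/
structure FracObj (W : ∀ ⦃X Y : B⦄, (X ⟶ Y) → Prop) (A T : B) where
  apex : B
  w : apex ⟶ A
  mem : W w
  f : apex ⟶ T

variable {W : ∀ ⦃X Y : B⦄, (X ⟶ Y) → Prop} {A T : B}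

variable (W) in
/-- An arrow is isomorphic to an arrow of the family `W`. -/
def IsoToMem {C A : B} (g : C ⟶ A) : Prop := ∃ w : C ⟶ A, W w ∧ Nonempty (w ≅ g)

/-- Quintuples `(C, u, v, α, ξ) : (C₁, w₁, f₁) → (C₂, w₂, f₂)`, where `α : w₁ u ≅ w₂ v` is
invertible, `ξ : f₁ u ⟹ f₂ v`, and `w₁ u` is isomorphic to an arrow of `W`. -/
structure FracPre (X Y : FracObj W A T) where
  apex : B
  u : apex ⟶ X.apex
  v : apex ⟶ Y.apex
  α : u ≫ X.w ≅ v ≫ Y.w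
  ξ : u ≫ X.f ⟶ v ≫ Y.f
  mem : IsoToMem W (u ≫ X.w)

namespace FracPre

variable {X Y Z : FracObj W A T}

/-- Homotopies `(C', h, k, γ, δ)` between quintuples `p = (C, u, v, α, ξ)` and
`q = (C̃, ũ, ṽ, α̃, ξ̃)`: arrows `h : C' ⟶ C`, `k : C' ⟶ C̃` and invertible 2-cells `γ : u h ≅ ũ k`,
`δ : v h ≅ ṽ k` such that `w₁ u h` is isomorphic to an arrow of `W` and the two pastings agree. -/
structure Homotopy (p q : FracPre X Y) where
  apex : B
  h : apex ⟶ p.apex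
  k : apex ⟶ q.apex
  γ : h ≫ p.u ≅ k ≫ q.u
  δ : h ≫ p.v ≅ k ≫ q.v
  mem : IsoToMem W ((h ≫ p.u) ≫ X.w)
  comm_α :
    γ.hom ▷ X.w ≫ (α_ k q.u X.w).hom ≫ k ◁ q.α.hom =
      (α_ h p.u X.w).hom ≫ h ◁ p.α.hom ≫ (α_ h p.v Y.w).inv ≫ δ.hom ▷ Y.w ≫ (α_ k q.v Y.w).hom
  comm_ξ :
    γ.hom ▷ X.f ≫ (α_ k q.u X.f).hom ≫ k ◁ q.ξ =
      (α_ h p.u X.f).hom ≫ h ◁ p.ξ ≫ (α_ h p.v Y.f).inv ≫ δ.hom ▷ Y.f ≫ (α_ k q.v Y.f).hom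

/-- Two quintuples are equivalent if there is a homotopy between them. -/
def Homotopic (p q : FracPre X Y) : Prop := Nonempty (Homotopy p q)

variable (X) in
/-- The quintuple `(C, 1_C, 1_C, 1, 1)` representing the identity of `(C, w, f)`. -/
def id : FracPre X X where
  apex := X.apex
  u := 𝟙 X.apex
  v := 𝟙 X.apex
  α := Iso.refl _
  ξ := 𝟙 _
  mem := ⟨X.w, X.mem, ⟨(λ_ X.w).symm⟩⟩

/-- The squares `(D, h, g, γ)`, with `γ : v h ≅ u' g` and `w₁ u h` isomorphic to an arrow of `W`,
that may be used to compose two quintuples. -/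
structure Square (p : FracPre X Y) (q : FracPre Y Z) where
  apex : B
  h : apex ⟶ p.apex
  g : apex ⟶ q.apex
  γ : h ≫ p.v ≅ g ≫ q.u
  mem : IsoToMem W ((h ≫ p.u) ≫ X.w)

/-- The composite of two quintuples along a square, obtained by pasting. -/
def comp (p : FracPre X Y) (q : FracPre Y Z) (s : Square p q) : FracPre X Z where
  apex := s.apex
  u := s.h ≫ p.u
  v := s.g ≫ q.v
  α := α_ s.h p.u X.w ≪≫ whiskerLeftIso s.h p.α ≪≫ (α_ s.h p.v Y.w).symm ≪≫
    whiskerRightIso s.γ Y.w ≪≫ α_ s.g q.u Y.w ≪≫ whiskerLeftIso s.g q.α ≪≫ (α_ s.g q.v Z.w).symm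
  ξ := (α_ s.h p.u X.f).hom ≫ s.h ◁ p.ξ ≫ (α_ s.h p.v Y.f).inv ≫
    s.γ.hom ▷ Y.f ≫ (α_ s.g q.u Y.f).hom ≫ s.g ◁ q.ξ ≫ (α_ s.g q.v Z.f).inv
  mem := s.mem

end FracPre

/-- Arrows of `𝓑[𝓦⁻¹](A, T)`: quintuples modulo homotopy. -/
def FracHom (X Y : FracObj W A T) := Quot (FracPre.Homotopic (X := X) (Y := Y))

/-- The class of a quintuple. -/
def FracHom.mk {X Y : FracObj W A T} (p : FracPre X Y) : FracHom X Y := Quot.mk _ p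

variable (W A T) in
/-- A category structure on the objects `FracObj W A T` and the arrows `FracHom`, whose identities
are the classes of the identity quintuples, and in which the composite of two classes is computed
by *every* choice of representatives and of a square. -/
structure FracCategory where
  comp {X Y Z : FracObj W A T} : FracHom X Y → FracHom Y Z → FracHom X Z
  comp_mk {X Y Z : FracObj W A T} (p : FracPre X Y) (q : FracPre Y Z) (s : p.Square q) :
    comp (FracHom.mk p) (FracHom.mk q) = FracHom.mk (p.comp q s)
  id_comp {X Y : FracObj W A T} (f : FracHom X Y) : comp (FracHom.mk (FracPre.id X)) f = f
  comp_id {X Y : FracObj W A T} (f : FracHom X Y) : comp f (FracHom.mk (FracPre.id Y)) = f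
  assoc {X Y Z V : FracObj W A T} (f : FracHom X Y) (g : FracHom Y Z) (h : FracHom Z V) :
    comp (comp f g) h = comp f (comp g h)

/-- The category `𝓑[𝓦⁻¹](A, T)`, as a type of objects. -/
def FracCategory.Carrier (_ : FracCategory W A T) := FracObj W A T

instance (S : FracCategory W A T) : Category S.Carrier where
  Hom X Y := FracHom (W := W) (A := A) (T := T) X Y
  id X := FracHom.mk (FracPre.id (W := W) (A := A) (T := T) X)
  comp f g := S.comp f g
  id_comp f := S.id_comp f
  comp_id f := S.comp_id f
  assoc f g h := S.assoc f g h

/-! ### The comparison -/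

/-- The pair `((C, w), f)` regarded as the triple `(C, w, f)`. -/
def ColimObj.toFrac (X : ColimObj (homDiagram W A T)) : FracObj W A T where
  apex := X.base.unop.dom
  w := X.base.unop.arr
  mem := X.base.unop.mem
  f := X.pt

/-- The premorphism `((C, w), (u, α_u), (v, α_v), ξ)` gives the quintuple
`(C, u, v, α_v α_u⁻¹, ξ)`. -/
def ColimPre.toFrac {X Y : ColimObj (homDiagram W A T)} (p : ColimPre X Y) :
    FracPre X.toFrac Y.toFrac where
  apex := p.apex.unop.dom
  u := p.u.unop.hom
  v := p.v.unop.hom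
  α := p.u.unop.iso.symm ≪≫ p.v.unop.iso
  ξ := p.ξ
  mem := ⟨p.apex.unop.arr, p.apex.unop.mem, ⟨p.u.unop.iso⟩⟩

end Frac

end BicatFrac

/-! Write `J` for the opposite of `𝓦/A`. Filteredness of `J` is used through diagrams shaped like
the suspension of a finite category `K`, that is, functors from `K` to a hom-category of `J`
(`exists_cocone`). An empty `K` gives cospans, two points make parallel arrows isomorphic, and a
parallel pair makes two 2-cells equal and invertible after whiskering. Together these yield squares
and `exists_amalgamation`: two invertible fillings over the same pair of arrows become compatible
further on.

For `Colim F`, the equation in a homotopy is rewritten as a commutative square between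
pushed-forward arrows (`Transports`). Pushing a premorphism forward does not change its class
(`homotopic_hat`), so composable classes have representatives `(l, a, b, ξ)`, `(l, b, c, ζ)` with
the same apex and the same middle arrow, and their composite is `ξ ≫ ζ` in `F l`. The one real issue
is that two homotopies may use different 2-cells on the middle arrow; amalgamation reconciles them
(`homotopic_comp`). Independence of all choices follows, and the category axioms reduce to those of
the fibres.

A pseudo-cocone `σ` sends `(l, a, b, ξ)` to `σ_a⁻¹`, then `σ_l ξ`, then `σ_b`. Functoriality and
naturality of `σ` make this invariant under homotopy. For the canonical cocone the formula returns
the class itself (`colimCocone_descMap`), so a functor or a transformation out of `Colim F` is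
determined by its restriction to the cocone.

Finally, every quintuple is the image of a premorphism, since the isomorphism from an arrow of `W`
to `w₁ u` makes its apex an object of `𝓦/A`. Homotopies and squares correspond too: the structural
2-cells over `A` can be solved for, and the equation on `α` is exactly what makes both 2-cells of a
homotopy lie over `A`. All assertions about fractions are therefore transported from `Colim F`. -/

namespace BicatFrac

/-! ### The suspension of a category -/

section Suspension

/-- The suspension of a category `K`: the bicategory with two objects, the hom-category `K` between
them, and only identities besides. -/
inductive Susp (K : Type) : Type
  | src
  | tgt

namespace Susp

variable (K : Type) [Category.{0} K]

/-- The 1-cells of the suspension. -/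
def Hom : Susp K → Susp K → Type
  | src, src => Discrete PUnit
  | src, tgt => K
  | tgt, src => Discrete PEmpty
  | tgt, tgt => Discrete PUnit

instance homCategory : (a b : Susp K) → Category.{0} (Hom K a b)
  | src, src => inferInstanceAs (Category (Discrete PUnit))
  | src, tgt => inferInstanceAs (Category K)
  | tgt, src => inferInstanceAs (Category (Discrete PEmpty))
  | tgt, tgt => inferInstanceAs (Category (Discrete PUnit))

variable {K} in
/-- Composition of 1-cells in the suspension. -/
def compHom : {a b c : Susp K} → Hom K a b → Hom K b c → Hom K a c
  | src, src, _, _, g => g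
  | src, tgt, tgt, f, _ => f
  | src, tgt, src, _, g => g.as.elim
  | tgt, tgt, _, _, g => g
  | tgt, src, _, f, _ => f.as.elim

variable {K} in
/-- Identity 1-cells in the suspension. -/
def idHom : (a : Susp K) → Hom K a a
  | src => ⟨⟨⟩⟩
  | tgt => ⟨⟨⟩⟩

instance : CategoryStruct (Susp K) where
  Hom := Hom K
  id := idHom
  comp := compHom

instance hom₂Category (a b : Susp K) : Category.{0} (a ⟶ b) := homCategory K a b

variable {K} in
/-- Left whiskering in the suspension. -/
def wl : {a b c : Susp K} → (f : a ⟶ b) → {g h : b ⟶ c} → (g ⟶ h) → (f ≫ g ⟶ f ≫ h)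
  | src, src, _, _, _, _, η => η
  | src, tgt, tgt, f, _, _, _ => 𝟙 f
  | src, tgt, src, _, g, _, _ => g.as.elim
  | tgt, tgt, _, _, _, _, η => η
  | tgt, src, _, f, _, _, _ => f.as.elim

variable {K} in
/-- Right whiskering in the suspension. -/
def wr : {a b c : Susp K} → {f g : a ⟶ b} → (f ⟶ g) → (h : b ⟶ c) → (f ≫ h ⟶ g ≫ h)
  | src, src, _, _, _, _, h => 𝟙 h
  | src, tgt, tgt, _, _, η, _ => η
  | src, tgt, src, _, _, _, h => h.as.elim
  | tgt, tgt, _, _, _, _, h => 𝟙 h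
  | tgt, src, _, f, _, _, _ => f.as.elim

omit [Category.{0} K] in
variable {K} in
theorem comp_assoc : {a b c d : Susp K} → (f : a ⟶ b) → (g : b ⟶ c) → (h : c ⟶ d) →
    (f ≫ g) ≫ h = f ≫ g ≫ h
  | src, src, _, _, _, _, _ => rfl
  | src, tgt, tgt, tgt, _, _, _ => rfl
  | src, tgt, tgt, src, _, _, h => h.as.elim
  | src, tgt, src, _, _, g, _ => g.as.elim
  | tgt, tgt, _, _, _, _, _ => rfl
  | tgt, src, _, _, f, _, _ => f.as.elim

omit [Category.{0} K] in
variable {K} in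
theorem id_comp' : {a b : Susp K} → (f : a ⟶ b) → 𝟙 a ≫ f = f
  | src, _, _ => rfl
  | tgt, _, _ => rfl

omit [Category.{0} K] in
variable {K} in
theorem comp_id' : {a b : Susp K} → (f : a ⟶ b) → f ≫ 𝟙 b = f
  | src, src, ⟨⟨⟩⟩ => rfl
  | src, tgt, _ => rfl
  | tgt, tgt, ⟨⟨⟩⟩ => rfl
  | tgt, src, f => f.as.elim

/-- A 1-cell `tgt ⟶ src` makes a case vacuous. In all the other cases the constraints are
identities, and the axioms reduce to unit laws in the hom-categories. -/
instance : Bicategory (Susp K) where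
  homCategory := hom₂Category K
  whiskerLeft := wl
  whiskerRight := wr
  associator f g h := eqToIso (comp_assoc f g h)
  leftUnitor f := eqToIso (id_comp' f)
  rightUnitor f := eqToIso (comp_id' f)
  whiskerLeft_id {a b c} f g := by
    cases a <;> cases b <;> cases c <;> first | exact f.as.elim | exact g.as.elim | rfl
  whiskerLeft_comp {a b c} f g h i η θ := by
    cases a <;> cases b <;> cases c <;>
      first | exact f.as.elim | exact g.as.elim | rfl | exact (Category.id_comp _).symm
  id_whiskerLeft {a b} f g η := by
    cases a <;> cases b <;> exact ((Category.id_comp _).trans (Category.comp_id _)).symm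
  comp_whiskerLeft {a b c d} f g h h' η := by
    cases a <;> cases b <;> cases c <;> cases d <;>
      first
      | exact f.as.elim | exact g.as.elim | exact h.as.elim
      | exact ((Category.id_comp _).trans (Category.comp_id _)).symm
  id_whiskerRight {a b c} f g := by
    cases a <;> cases b <;> cases c <;> first | exact f.as.elim | exact g.as.elim | rfl
  comp_whiskerRight {a b c} f g h η θ i := by
    cases a <;> cases b <;> cases c <;>
      first | exact f.as.elim | exact i.as.elim | rfl | exact (Category.id_comp _).symm
  whiskerRight_id {a b} f g η := by
    cases a <;> cases b <;>
      first
      | exact f.as.elim | rfl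
      | exact ((Category.id_comp _).trans (Category.comp_id _)).symm
  whiskerRight_comp {a b c d} f f' η g h := by
    cases a <;> cases b <;> cases c <;> cases d <;>
      first
      | exact f.as.elim | exact g.as.elim | exact h.as.elim
      | exact ((Category.id_comp _).trans (Category.comp_id _)).symm
  whisker_assoc {a b c d} f g g' η h := by
    cases a <;> cases b <;> cases c <;> cases d <;>
      first
      | exact f.as.elim | exact g.as.elim | exact h.as.elim
      | exact ((Category.id_comp _).trans (Category.comp_id _)).symm
  whisker_exchange {a b c} f g h i η θ := by
    cases a <;> cases b <;> cases c <;>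
      first
      | exact f.as.elim | exact h.as.elim
      | exact (Category.id_comp _).trans (Category.comp_id _).symm
      | exact (Category.comp_id _).trans (Category.id_comp _).symm
  pentagon {a b c d e} f g h i := by
    cases a <;> cases b <;> cases c <;> cases d <;> cases e <;>
      first
      | exact f.as.elim | exact g.as.elim | exact h.as.elim | exact i.as.elim
      | exact Category.id_comp _
  triangle {a b c} f g := by
    cases a <;> cases b <;> cases c <;>
      first
      | exact f.as.elim | exact g.as.elim
      | exact Category.id_comp _

section Functor

variable {K} {J : Type u} [Bicategory.{w, v} J] {x y : J} (G : K ⥤ (x ⟶ y))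

/-- The action on objects of the pseudo-functor associated with `G`. -/
def liftObj (_ : K ⥤ (x ⟶ y)) : Susp K → J
  | src => x
  | tgt => y

/-- The action on 1-cells of the pseudo-functor associated with `G`. -/
def liftMap : {a b : Susp K} → (a ⟶ b) → (liftObj G a ⟶ liftObj G b)
  | src, src, _ => 𝟙 x
  | src, tgt, f => G.obj f
  | tgt, tgt, _ => 𝟙 y
  | tgt, src, f => f.as.elim

/-- The action on 2-cells of the pseudo-functor associated with `G`. -/
def liftMap₂ : {a b : Susp K} → {f g : a ⟶ b} → (f ⟶ g) → (liftMap G f ⟶ liftMap G g)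
  | src, src, _, _, _ => 𝟙 (𝟙 x)
  | src, tgt, _, _, η => G.map η
  | tgt, tgt, _, _, _ => 𝟙 (𝟙 y)
  | tgt, src, f, _, _ => f.as.elim

/-- The unit constraint of the pseudo-functor associated with `G`. -/
def liftMapId : (a : Susp K) → (liftMap G (𝟙 a) ≅ 𝟙 (liftObj G a))
  | src => Iso.refl (𝟙 x)
  | tgt => Iso.refl (𝟙 y)

/-- The composition constraint of the pseudo-functor associated with `G`. -/
def liftMapComp : {a b c : Susp K} → (f : a ⟶ b) → (g : b ⟶ c) →
    (liftMap G (f ≫ g) ≅ liftMap G f ≫ liftMap G g)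
  | src, src, _, _, g => (λ_ (liftMap G g)).symm
  | src, tgt, tgt, f, _ => (ρ_ (G.obj f)).symm
  | src, tgt, src, _, g => g.as.elim
  | tgt, tgt, _, _, g => (λ_ (liftMap G g)).symm
  | tgt, src, _, f, _ => f.as.elim

/-- A functor `K ⥤ (x ⟶ y)` induces a pseudo-functor from the suspension of `K`. -/
def lift : Susp K ⥤ᵖ J where
  obj := liftObj G
  map := liftMap G
  map₂ := liftMap₂ G
  map₂_id {a b} f := by
    cases a <;> cases b <;> first | exact f.as.elim | rfl | exact G.map_id _
  map₂_comp {a b f g h} η θ := by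
    cases a <;> cases b <;>
      first | exact f.as.elim | exact G.map_comp _ _ | exact (Category.id_comp _).symm
  mapId := liftMapId G
  mapComp := liftMapComp G
  map₂_whisker_left {a b c} f g h η := by
    have hl : ∀ {a b : J} {p q : a ⟶ b} (θ : p ⟶ q),
        θ = (λ_ p).inv ≫ 𝟙 a ◁ θ ≫ (λ_ q).hom := by intros; simp
    have hr : ∀ {a b : J} (p : a ⟶ b), 𝟙 p = (ρ_ p).inv ≫ p ◁ 𝟙 (𝟙 b) ≫ (ρ_ p).hom := by
      intros; simp
    cases a <;> cases b <;> cases c <;>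
      first
      | exact f.as.elim | exact g.as.elim
      | exact hl _
      | exact (G.map_id _).trans (hr _)
  map₂_whisker_right {a b c f g} η h := by
    have hl : ∀ {a b : J} (p : a ⟶ b), 𝟙 p = (λ_ p).inv ≫ 𝟙 (𝟙 a) ▷ p ≫ (λ_ p).hom := by
      intros; simp
    have hr : ∀ {a b : J} {p q : a ⟶ b} (θ : p ⟶ q),
        θ = (ρ_ p).inv ≫ θ ▷ 𝟙 b ≫ (ρ_ q).hom := by intros; simp
    cases a <;> cases b <;> cases c <;>
      first
      | exact f.as.elim | exact h.as.elim
      | exact hl _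
      | exact (G.map_id _).trans (hl _)
      | exact hr _
  map₂_associator {a b c d} f g h := by
    -- One coherence identity for each position of the only possibly non-identity 1-cell in the
    -- triple: last, middle, first.
    have h₁ : ∀ {a b : J} (p : a ⟶ b), 𝟙 p = (λ_ p).inv ≫ (λ_ (𝟙 a)).inv ▷ p ≫
        (α_ (𝟙 a) (𝟙 a) p).hom ≫ 𝟙 a ◁ (λ_ p).hom ≫ (λ_ p).hom := by
      intros; simp
    have h₂ : ∀ {a b : J} (p : a ⟶ b), 𝟙 p = (ρ_ p).inv ≫ (λ_ p).inv ▷ 𝟙 b ≫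
        (α_ (𝟙 a) p (𝟙 b)).hom ≫ 𝟙 a ◁ (ρ_ p).hom ≫ (λ_ p).hom := by
      intros; simp
    have h₃ : ∀ {a b : J} (p : a ⟶ b), 𝟙 p = (ρ_ p).inv ≫ (ρ_ p).inv ▷ 𝟙 b ≫
        (α_ p (𝟙 b) (𝟙 b)).hom ≫ p ◁ (λ_ (𝟙 b)).hom ≫ (ρ_ p).hom := by
      intros; simp
    cases a <;> cases b <;> cases c <;> cases d <;>
      first
      | exact f.as.elim | exact g.as.elim | exact h.as.elim
      | exact h₁ _
      | exact (G.map_id _).trans (h₁ _)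
      | exact (G.map_id _).trans (h₂ _)
      | exact (G.map_id _).trans (h₃ _)
  map₂_left_unitor {a b} f := by
    have h₁ : ∀ {a b : J} (p : a ⟶ b), 𝟙 p = (λ_ p).inv ≫ 𝟙 (𝟙 a) ▷ p ≫ (λ_ p).hom := by
      intros; simp
    cases a <;> cases b <;>
      first
      | exact f.as.elim | exact h₁ _ | exact (G.map_id _).trans (h₁ _)
  map₂_right_unitor {a b} f := by
    have h₁ : ∀ {a b : J} (p : a ⟶ b), 𝟙 p = (ρ_ p).inv ≫ p ◁ 𝟙 (𝟙 b) ≫ (ρ_ p).hom := by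
      intros; simp
    have h₂ : ∀ a : J, 𝟙 (𝟙 a) = (λ_ (𝟙 a)).inv ≫ 𝟙 a ◁ 𝟙 (𝟙 a) ≫ (ρ_ (𝟙 a)).hom := by
      intros; simp
    cases a <;> cases b <;>
      first
      | exact f.as.elim | exact h₂ _ | exact (G.map_id _).trans (h₁ _)

end Functor

instance : Finite (Susp K) :=
  Finite.of_injective (β := Bool) (fun | src => false | tgt => true)
    (by rintro (_ | _) (_ | _) h <;> first | rfl | cases h)

omit [Category.{0} K] in
variable {K} in
theorem finite_hom [Finite K] (a b : Susp K) : Finite (a ⟶ b) := by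
  cases a <;> cases b
  · exact inferInstanceAs (Finite (Discrete PUnit))
  · exact inferInstanceAs (Finite K)
  · exact inferInstanceAs (Finite (Discrete PEmpty))
  · exact inferInstanceAs (Finite (Discrete PUnit))

variable {K} in
theorem finite_hom₂ (hK : ∀ k l : K, Finite (k ⟶ l)) (a b : Susp K) (f g : a ⟶ b) :
    Finite (f ⟶ g) := by
  have hu : ∀ p q : Discrete PUnit.{1}, Finite (p ⟶ q) := fun _ _ => inferInstance
  cases a <;> cases b
  · exact hu f g
  · exact hK f g
  · exact f.as.elim
  · exact hu f g

end Susp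
end Suspension

/-! ### Elementary consequences of filteredness. -/

namespace IsFilteredBicat

variable {J : Type u} [Bicategory.{w, v} J]

/-- This is a pseudo-cocone on the suspension of `G`, unpacked: two legs, the structure cells at the
objects of `K`, and naturality in the arrows of `K`. -/
theorem exists_cocone (hJ : IsFilteredBicat J) {K : Type} [Category.{0} K] [Finite K]
    (hK : ∀ k l : K, Finite (k ⟶ l)) {x y : J} (G : K ⥤ (x ⟶ y)) :
    ∃ (z : J) (f : x ⟶ z) (g : y ⟶ z) (e : ∀ k, G.obj k ≫ g ≅ f),
      ∀ {k l : K} (η : k ⟶ l), G.map η ▷ g ≫ (e l).hom = (e k).hom := by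
  obtain ⟨z, ⟨θ⟩⟩ := hJ.2 (Susp K) inferInstance Susp.finite_hom (Susp.finite_hom₂ hK)
    (Susp.lift G)
  exact ⟨z, θ.leg .src, θ.leg .tgt, fun k => θ.iso (a := .src) (b := .tgt) k,
    fun η => θ.naturality (a := .src) (b := .tgt) η⟩

theorem exists_cospan (hJ : IsFilteredBicat J) (x y : J) :
    ∃ z : J, Nonempty (x ⟶ z) ∧ Nonempty (y ⟶ z) := by
  obtain ⟨z, f, g, -⟩ := hJ.exists_cocone (K := Discrete PEmpty) (fun _ _ => inferInstance)
    (Discrete.functor (PEmpty.elim : PEmpty → (x ⟶ y)))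
  exact ⟨z, ⟨f⟩, ⟨g⟩⟩

theorem exists_iso (hJ : IsFilteredBicat J) {x y : J} (f g : x ⟶ y) :
    ∃ (z : J) (h : y ⟶ z), Nonempty (f ≫ h ≅ g ≫ h) := by
  obtain ⟨z, _, h, e, -⟩ := hJ.exists_cocone (K := Discrete Bool) (fun _ _ => inferInstance)
    (Discrete.functor (fun b => bif b then f else g))
  exact ⟨z, h, ⟨e ⟨true⟩ ≪≫ (e ⟨false⟩).symm⟩⟩

theorem exists_square (hJ : IsFilteredBicat J) {x y z : J} (f : x ⟶ y) (g : x ⟶ z) :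
    ∃ (t : J) (h : y ⟶ t) (k : z ⟶ t), Nonempty (f ≫ h ≅ g ≫ k) := by
  obtain ⟨s, ⟨h⟩, ⟨k⟩⟩ := hJ.exists_cospan y z
  obtain ⟨t, l, ⟨e⟩⟩ := hJ.exists_iso (f ≫ h) (g ≫ k)
  exact ⟨t, h ≫ l, k ≫ l, ⟨(α_ f h l).symm ≪≫ e ≪≫ α_ g k l⟩⟩

/-- Naturality of a cocone on the parallel pair forces both whiskered 2-cells to be `e₀ e₁⁻¹`, with
`e₀`, `e₁` its invertible structure cells. Hence they coincide and are invertible, even if `η` and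
`θ` are not. -/
theorem exists_whiskerRight_eq_and_isIso (hJ : IsFilteredBicat J) {x y : J} {f g : x ⟶ y}
    (η θ : f ⟶ g) : ∃ (z : J) (h : y ⟶ z), η ▷ h = θ ▷ h ∧ IsIso (η ▷ h) := by
  obtain ⟨z, _, h, e, he⟩ := hJ.exists_cocone (K := Limits.WalkingParallelPair)
    (fun _ _ => inferInstance) (Limits.parallelPair η θ)
  have h₁ : η ▷ h = (e .zero).hom ≫ (e .one).inv :=
    (Iso.eq_comp_inv _).2 (he Limits.WalkingParallelPairHom.left)
  have h₂ : θ ▷ h = (e .zero).hom ≫ (e .one).inv :=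
    (Iso.eq_comp_inv _).2 (he Limits.WalkingParallelPairHom.right)
  exact ⟨z, h, h₁.trans h₂.symm, h₁ ▸ inferInstance⟩

end IsFilteredBicat

/-- Postcomposition of an invertible 2-cell filling a square. -/
def postIso {J : Type u} [Bicategory.{w, v} J] {i j k l n : J} {b : i ⟶ j} {b' : i ⟶ k}
    {m : j ⟶ l} {m' : k ⟶ l} (β : b ≫ m ≅ b' ≫ m') (r : l ⟶ n) :
    b ≫ m ≫ r ≅ b' ≫ m' ≫ r :=
  (α_ b m r).symm ≪≫ whiskerRightIso β r ≪≫ α_ b' m' r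

/-- Used to make the 2-cells that two homotopies carry on a shared middle arrow agree, so that the
homotopies can be pasted. -/
theorem IsFilteredBicat.exists_amalgamation {J : Type u} [Bicategory.{w, v} J]
    (hJ : IsFilteredBicat J) {i j k l₁ l₂ : J} {b : i ⟶ j} {b' : i ⟶ k}
    {m₁ : j ⟶ l₁} {m₁' : k ⟶ l₁} {m₂ : j ⟶ l₂} {m₂' : k ⟶ l₂}
    (β₁ : b ≫ m₁ ≅ b' ≫ m₁') (β₂ : b ≫ m₂ ≅ b' ≫ m₂') :
    ∃ (n : J) (r₁ : l₁ ⟶ n) (r₂ : l₂ ⟶ n) (φ : m₁ ≫ r₁ ≅ m₂ ≫ r₂) (φ' : m₁' ≫ r₁ ≅ m₂' ≫ r₂),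
      (postIso β₁ r₁).hom ≫ b' ◁ φ'.hom = b ◁ φ.hom ≫ (postIso β₂ r₂).hom := by
  obtain ⟨n, r₁, r₂, ⟨φ⟩⟩ := hJ.exists_square m₁ m₂
  obtain ⟨n', s, ⟨φ'⟩⟩ := hJ.exists_iso (m₁' ≫ r₁) (m₂' ≫ r₂)
  let ψ : m₁ ≫ r₁ ≫ s ≅ m₂ ≫ r₂ ≫ s := postIso φ s
  let ψ' : m₁' ≫ r₁ ≫ s ≅ m₂' ≫ r₂ ≫ s := (α_ _ _ _).symm ≪≫ φ' ≪≫ α_ _ _ _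
  -- `ψ` and `ψ'` were chosen independently of each other and of `β₁`, `β₂`; a further arrow `t`
  -- equalizes the two resulting pastings.
  obtain ⟨n'', t, ht, -⟩ := hJ.exists_whiskerRight_eq_and_isIso
    ((postIso β₁ (r₁ ≫ s)).hom ≫ b' ◁ ψ'.hom) (b ◁ ψ.hom ≫ (postIso β₂ (r₂ ≫ s)).hom)
  refine ⟨n'', (r₁ ≫ s) ≫ t, (r₂ ≫ s) ≫ t, postIso ψ t, postIso ψ' t, ?_⟩
  have h₁ : (postIso β₁ ((r₁ ≫ s) ≫ t)).hom ≫ b' ◁ (postIso ψ' t).hom =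
      b ◁ (α_ m₁ (r₁ ≫ s) t).inv ≫ (α_ b _ t).inv ≫
      ((postIso β₁ (r₁ ≫ s)).hom ≫ b' ◁ ψ'.hom) ▷ t ≫ (α_ b' _ t).hom ≫
        b' ◁ (α_ m₂' (r₂ ≫ s) t).hom := by
    -- Only the type of `ψ'` matters; its definition is hidden from `simp`.
    generalize ψ' = ψ'
    simp [postIso]
  have h₂ : b ◁ (postIso ψ t).hom ≫ (postIso β₂ ((r₂ ≫ s) ≫ t)).hom =
      b ◁ (α_ m₁ (r₁ ≫ s) t).inv ≫ (α_ b _ t).inv ≫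
      (b ◁ ψ.hom ≫ (postIso β₂ (r₂ ≫ s)).hom) ▷ t ≫ (α_ b' _ t).hom ≫
        b' ◁ (α_ m₂' (r₂ ≫ s) t).hom := by
    generalize ψ = ψ
    simp [postIso]
  rw [h₁, h₂, ht]

/-! ### Componentwise form of the axioms of a `Cat`-valued pseudo-functor -/

section CatValued

variable {J : Type u₁} [Bicategory.{w', v₁} J] (F : J ⥤ᵖ Cat.{v', u'})

/-- The component at `x` of the image of a 2-cell. -/
abbrev cellApp {a b : J} {u v : a ⟶ b} (η : u ⟶ v) (x : F.obj a) :
    (F.map u).toFunctor.obj x ⟶ (F.map v).toFunctor.obj x :=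
  (F.map₂ η).toNatTrans.app x

variable {F}

theorem cellApp_id {a b : J} (u : a ⟶ b) (x : F.obj a) : cellApp F (𝟙 u) x = 𝟙 _ := by
  simp [cellApp]

theorem cellApp_comp {a b : J} {u v w : a ⟶ b} (η : u ⟶ v) (θ : v ⟶ w) (x : F.obj a) :
    cellApp F (η ≫ θ) x = cellApp F η x ≫ cellApp F θ x := by
  simp [cellApp]

theorem cellApp_hom_inv {a b : J} {u v : a ⟶ b} (η : u ≅ v) (x : F.obj a) :
    cellApp F η.hom x ≫ cellApp F η.inv x = 𝟙 _ := by
  rw [← cellApp_comp, η.hom_inv_id, cellApp_id]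

theorem cellApp_inv_hom {a b : J} {u v : a ⟶ b} (η : u ≅ v) (x : F.obj a) :
    cellApp F η.inv x ≫ cellApp F η.hom x = 𝟙 _ := by
  rw [← cellApp_comp, η.inv_hom_id, cellApp_id]

theorem cellApp_naturality {a b : J} {u v : a ⟶ b} (η : u ⟶ v) {x y : F.obj a} (φ : x ⟶ y) :
    (F.map u).toFunctor.map φ ≫ cellApp F η y = cellApp F η x ≫ (F.map v).toFunctor.map φ :=
  (F.map₂ η).toNatTrans.naturality φ

theorem mapComp_inv_naturality {a b c : J} (u : a ⟶ b) (v : b ⟶ c) {x y : F.obj a} (φ : x ⟶ y) :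
    (F.map v).toFunctor.map ((F.map u).toFunctor.map φ) ≫ (F.mapComp u v).inv.toNatTrans.app y =
      (F.mapComp u v).inv.toNatTrans.app x ≫ (F.map (u ≫ v)).toFunctor.map φ :=
  (F.mapComp u v).inv.toNatTrans.naturality φ

theorem mapId_hom_naturality (a : J) {x y : F.obj a} (φ : x ⟶ y) :
    (F.map (𝟙 a)).toFunctor.map φ ≫ (F.mapId a).hom.toNatTrans.app y =
      (F.mapId a).hom.toNatTrans.app x ≫ φ :=
  (F.mapId a).hom.toNatTrans.naturality φ

theorem cellApp_whiskerLeft {a b c : J} (u : a ⟶ b) {v w : b ⟶ c} (η : v ⟶ w) (x : F.obj a) :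
    cellApp F (u ◁ η) x = (F.mapComp u v).hom.toNatTrans.app x ≫
      cellApp F η ((F.map u).toFunctor.obj x) ≫ (F.mapComp u w).inv.toNatTrans.app x := by
  unfold cellApp
  rw [F.map₂_whisker_left]
  rfl

theorem cellApp_whiskerRight {a b c : J} {u v : a ⟶ b} (η : u ⟶ v) (w : b ⟶ c) (x : F.obj a) :
    cellApp F (η ▷ w) x = (F.mapComp u w).hom.toNatTrans.app x ≫
      (F.map w).toFunctor.map (cellApp F η x) ≫ (F.mapComp v w).inv.toNatTrans.app x := by
  unfold cellApp
  rw [F.map₂_whisker_right]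
  rfl

theorem cellApp_associator_hom {a b c d : J} (u : a ⟶ b) (v : b ⟶ c) (w : c ⟶ d) (x : F.obj a) :
    cellApp F (α_ u v w).hom x = (F.mapComp (u ≫ v) w).hom.toNatTrans.app x ≫
      (F.map w).toFunctor.map ((F.mapComp u v).hom.toNatTrans.app x) ≫
      (F.mapComp v w).inv.toNatTrans.app ((F.map u).toFunctor.obj x) ≫
      (F.mapComp u (v ≫ w)).inv.toNatTrans.app x := by
  unfold cellApp
  rw [F.map₂_associator]
  -- The associator of `Cat` has identity components.
  exact congrArg _ (congrArg _ (Category.id_comp _))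

theorem cellApp_leftUnitor_hom {a b : J} (u : a ⟶ b) (x : F.obj a) :
    cellApp F (λ_ u).hom x = (F.mapComp (𝟙 a) u).hom.toNatTrans.app x ≫
      (F.map u).toFunctor.map ((F.mapId a).hom.toNatTrans.app x) := by
  unfold cellApp
  rw [F.map₂_left_unitor]
  exact congrArg _ (Category.comp_id _)

theorem cellApp_rightUnitor_hom {a b : J} (u : a ⟶ b) (x : F.obj a) :
    cellApp F (ρ_ u).hom x = (F.mapComp u (𝟙 b)).hom.toNatTrans.app x ≫
      (F.mapId b).hom.toNatTrans.app ((F.map u).toFunctor.obj x) := by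
  unfold cellApp
  rw [F.map₂_right_unitor]
  exact congrArg _ (Category.comp_id _)

/-- The left and right unitors of `𝟙 a` coincide; their components are then compared and the
invertible constraint is cancelled. -/
theorem mapId_hom_app_map_id (a : J) (x : F.obj a) :
    (F.mapId a).hom.toNatTrans.app ((F.map (𝟙 a)).toFunctor.obj x) =
      (F.map (𝟙 a)).toFunctor.map ((F.mapId a).hom.toNatTrans.app x) := by
  have h := cellApp_rightUnitor_hom (𝟙 a) x
  rw [← unitors_equal, cellApp_leftUnitor_hom] at h
  have := congrArg (fun t => (F.mapComp (𝟙 a) (𝟙 a)).inv.toNatTrans.app x ≫ t) h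
  simpa only [Cat.Hom.inv_hom_id_toNatTrans_app_assoc] using this.symm

open ColimPre (hat)

section Hat

variable {a b c d e : J} {u : a ⟶ d} {v : b ⟶ d} {x : F.obj a} {y : F.obj b}

theorem hat_id (k : d ⟶ e) : hat u u k (𝟙 ((F.map u).toFunctor.obj x)) = 𝟙 _ := by
  simp [hat]

/-- Pushing along `k` is the functor `F k` conjugated by the constraints, hence functorial. -/
theorem hat_comp {t : c ⟶ d} {z : F.obj c} (k : d ⟶ e)
    (ξ : (F.map u).toFunctor.obj x ⟶ (F.map v).toFunctor.obj y)
    (ζ : (F.map v).toFunctor.obj y ⟶ (F.map t).toFunctor.obj z) :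
    hat u t k (ξ ≫ ζ) = hat u v k ξ ≫ hat v t k ζ := by
  simp [hat]

theorem hat_cellApp {u' : a ⟶ d} (η : u ⟶ u') (k : d ⟶ e) :
    hat u u' k (cellApp F η x) = cellApp F (η ▷ k) x :=
  (cellApp_whiskerRight η k x).symm

end Hat

/-- The invertible 2-cells `α`, `β` transport `ξ` to `ζ`. -/
def Transports {a b c : J} {u u' : a ⟶ c} {v v' : b ⟶ c} (α : u ⟶ u') (β : v ⟶ v')
    {x : F.obj a} {y : F.obj b} (ξ : (F.map u).toFunctor.obj x ⟶ (F.map v).toFunctor.obj y)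
    (ζ : (F.map u').toFunctor.obj x ⟶ (F.map v').toFunctor.obj y) : Prop :=
  ξ ≫ cellApp F β y = cellApp F α x ≫ ζ

/-! ### Calculus of transported arrows. -/

namespace Transports

variable {a b c d e : J} {x : F.obj a} {y : F.obj b}

theorem refl {u : a ⟶ d} {v : b ⟶ d}
    (ξ : (F.map u).toFunctor.obj x ⟶ (F.map v).toFunctor.obj y) :
    Transports (𝟙 u) (𝟙 v) ξ ξ := by
  rw [Transports, cellApp_id, cellApp_id, Category.id_comp, Category.comp_id]

theorem trans {u u' u'' : a ⟶ d} {v v' v'' : b ⟶ d} {α : u ⟶ u'} {α' : u' ⟶ u''} {β : v ⟶ v'}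
    {β' : v' ⟶ v''} {ξ : (F.map u).toFunctor.obj x ⟶ (F.map v).toFunctor.obj y}
    {ζ : (F.map u').toFunctor.obj x ⟶ (F.map v').toFunctor.obj y}
    {θ : (F.map u'').toFunctor.obj x ⟶ (F.map v'').toFunctor.obj y}
    (h : Transports α β ξ ζ) (h' : Transports α' β' ζ θ) :
    Transports (α ≫ α') (β ≫ β') ξ θ := by
  unfold Transports at *
  rw [cellApp_comp, cellApp_comp, ← Category.assoc, h, Category.assoc, h', Category.assoc]

theorem symm {u u' : a ⟶ d} {v v' : b ⟶ d} {α : u ≅ u'} {β : v ≅ v'}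
    {ξ : (F.map u).toFunctor.obj x ⟶ (F.map v).toFunctor.obj y}
    {ζ : (F.map u').toFunctor.obj x ⟶ (F.map v').toFunctor.obj y}
    (h : Transports α.hom β.hom ξ ζ) : Transports α.inv β.inv ζ ξ := by
  unfold Transports at *
  have := congrArg (fun t => cellApp F α.inv x ≫ t ≫ cellApp F β.inv y) h
  simpa only [Category.assoc, cellApp_hom_inv, Category.comp_id,
    reassoc_of% cellApp_inv_hom α x] using this.symm

/-- Two squares are pasted side by side, so they must carry the same 2-cell `β` on the middle arrow.
-/
theorem hcomp {z : F.obj c} {u u' : a ⟶ d} {v v' : b ⟶ d} {t t' : c ⟶ d} {α : u ⟶ u'}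
    {β : v ⟶ v'} {γ : t ⟶ t'} {ξ : (F.map u).toFunctor.obj x ⟶ (F.map v).toFunctor.obj y}
    {ξ' : (F.map u').toFunctor.obj x ⟶ (F.map v').toFunctor.obj y}
    {ζ : (F.map v).toFunctor.obj y ⟶ (F.map t).toFunctor.obj z}
    {ζ' : (F.map v').toFunctor.obj y ⟶ (F.map t').toFunctor.obj z}
    (h : Transports α β ξ ξ') (h' : Transports β γ ζ ζ') : Transports α γ (ξ ≫ ζ) (ξ' ≫ ζ') := by
  unfold Transports at *
  rw [Category.assoc, h', ← Category.assoc, h, Category.assoc]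

theorem hat {u u' : a ⟶ d} {v v' : b ⟶ d} {α : u ⟶ u'} {β : v ⟶ v'}
    {ξ : (F.map u).toFunctor.obj x ⟶ (F.map v).toFunctor.obj y}
    {ζ : (F.map u').toFunctor.obj x ⟶ (F.map v').toFunctor.obj y}
    (h : Transports α β ξ ζ) (k : d ⟶ e) :
    Transports (α ▷ k) (β ▷ k) (hat u v k ξ) (hat u' v' k ζ) := by
  unfold Transports at *
  rw [← hat_cellApp, ← hat_cellApp, ← hat_comp, ← hat_comp, h]

variable {u : a ⟶ c} {v : b ⟶ c} (ξ : (F.map u).toFunctor.obj x ⟶ (F.map v).toFunctor.obj y)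

/-- Naturality of `F κ` at `ξ`. With the two lemmas that follow, it makes pushing forward
pseudo-functorial in the arrow pushed along. -/
theorem whiskerLeft {k k' : c ⟶ d} (κ : k ⟶ k') :
    Transports (u ◁ κ) (v ◁ κ) (ColimPre.hat u v k ξ) (ColimPre.hat u v k' ξ) := by
  unfold Transports
  rw [cellApp_whiskerLeft, cellApp_whiskerLeft]
  simp only [ColimPre.hat, Category.assoc, Cat.Hom.inv_hom_id_toNatTrans_app_assoc]
  rw [reassoc_of% cellApp_naturality κ ξ]

theorem associator (k : c ⟶ d) (l : d ⟶ e) :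
    Transports (α_ u k l).hom (α_ v k l).hom (ColimPre.hat (u ≫ k) (v ≫ k) l (ColimPre.hat u v k ξ))
      (ColimPre.hat u v (k ≫ l) ξ) := by
  unfold Transports
  rw [cellApp_associator_hom, cellApp_associator_hom]
  simp only [ColimPre.hat, Category.assoc, Cat.Hom.inv_hom_id_toNatTrans_app_assoc,
    Functor.map_comp]
  rw [← reassoc_of% mapComp_inv_naturality k l ξ, ← Functor.map_comp_assoc (F.map l).toFunctor
    ((F.mapComp v k).inv.toNatTrans.app y), Cat.Hom.inv_hom_id_toNatTrans_app]
  erw [CategoryTheory.Functor.map_id, Category.id_comp]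

theorem rightUnitor :
    Transports (ρ_ u).hom (ρ_ v).hom (ColimPre.hat u v (𝟙 c) ξ) ξ := by
  unfold Transports
  rw [cellApp_rightUnitor_hom, cellApp_rightUnitor_hom]
  simp only [ColimPre.hat, Category.assoc, Cat.Hom.inv_hom_id_toNatTrans_app_assoc]
  rw [mapId_hom_naturality]

end Transports

end CatValued

/-! ### The category of premorphisms modulo homotopy -/

section Colim

variable {J : Type u₁} [Bicategory.{w', v₁} J] {F : J ⥤ᵖ Cat.{v', u'}}

namespace ColimPre

variable {X Y Z : ColimObj F}

/-- The two equations differ by composition with invertible constraints at both ends. -/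
theorem comm_iff_transports {p q : ColimPre X Y} {l : J} {w₁ : p.apex ⟶ l} {w₂ : q.apex ⟶ l}
    (α : p.u ≫ w₁ ≅ q.u ≫ w₂) (β : p.v ≫ w₁ ≅ q.v ≫ w₂) :
    ((F.mapComp p.u w₁).inv.toNatTrans.app X.pt ≫ (F.map₂ α.hom).toNatTrans.app X.pt ≫
        (F.mapComp q.u w₂).hom.toNatTrans.app X.pt ≫ (F.map w₂).toFunctor.map q.ξ =
      (F.map w₁).toFunctor.map p.ξ ≫ (F.mapComp p.v w₁).inv.toNatTrans.app Y.pt ≫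
        (F.map₂ β.hom).toNatTrans.app Y.pt ≫ (F.mapComp q.v w₂).hom.toNatTrans.app Y.pt) ↔
    Transports α.hom β.hom (hat p.u p.v w₁ p.ξ) (hat q.u q.v w₂ q.ξ) := by
  unfold Transports hat
  constructor
  · intro h
    have := congrArg (fun t => (F.mapComp p.u w₁).hom.toNatTrans.app X.pt ≫ t ≫
      (F.mapComp q.v w₂).inv.toNatTrans.app Y.pt) h
    simpa using this.symm
  · intro h
    have := congrArg (fun t => (F.mapComp p.u w₁).inv.toNatTrans.app X.pt ≫ t ≫
      (F.mapComp q.v w₂).hom.toNatTrans.app Y.pt) h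
    simpa using this.symm

theorem homotopic_iff {p q : ColimPre X Y} :
    Homotopic p q ↔ ∃ (l : J) (w₁ : p.apex ⟶ l) (w₂ : q.apex ⟶ l) (α : p.u ≫ w₁ ≅ q.u ≫ w₂)
      (β : p.v ≫ w₁ ≅ q.v ≫ w₂),
      Transports α.hom β.hom (hat p.u p.v w₁ p.ξ) (hat q.u q.v w₂ q.ξ) :=
  ⟨fun ⟨H⟩ => ⟨H.apex, H.w₁, H.w₂, H.α, H.β, (comm_iff_transports _ _).1 H.comm⟩,
    fun ⟨l, w₁, w₂, α, β, h⟩ => ⟨⟨l, w₁, w₂, α, β, (comm_iff_transports α β).2 h⟩⟩⟩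

/-- A homotopy remains one after its apex is moved along `r`. -/
theorem transports_postIso {a b c d e n : J} {x : F.obj a} {y : F.obj b}
    {u : a ⟶ c} {v : b ⟶ c} {u' : a ⟶ d} {v' : b ⟶ d} {k : c ⟶ e} {k' : d ⟶ e}
    {α : u ≫ k ≅ u' ≫ k'} {β : v ≫ k ≅ v' ≫ k'}
    {ξ : (F.map u).toFunctor.obj x ⟶ (F.map v).toFunctor.obj y}
    {ζ : (F.map u').toFunctor.obj x ⟶ (F.map v').toFunctor.obj y}
    (h : Transports α.hom β.hom (hat u v k ξ) (hat u' v' k' ζ)) (r : e ⟶ n) :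
    Transports (postIso α r).hom (postIso β r).hom (hat u v (k ≫ r) ξ) (hat u' v' (k' ≫ r) ζ) :=
  (Transports.symm (α := α_ u k r) (β := α_ v k r) (.associator ξ k r)).trans
    ((h.hat r).trans (.associator ζ k' r))

theorem Homotopic.refl (p : ColimPre X Y) : Homotopic p p :=
  homotopic_iff.2 ⟨p.apex, 𝟙 _, 𝟙 _, Iso.refl _, Iso.refl _, .refl _⟩

theorem Homotopic.symm {p q : ColimPre X Y} (h : Homotopic p q) : Homotopic q p := by
  obtain ⟨l, w₁, w₂, α, β, h⟩ := homotopic_iff.1 h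
  exact homotopic_iff.2 ⟨l, w₂, w₁, α.symm, β.symm, h.symm⟩

theorem Homotopic.trans (hJ : IsFilteredBicat J) {p q r : ColimPre X Y} (h : Homotopic p q)
    (h' : Homotopic q r) : Homotopic p r := by
  obtain ⟨l, w₁, w₂, α, β, h⟩ := homotopic_iff.1 h
  obtain ⟨l', w₁', w₂', α', β', h'⟩ := homotopic_iff.1 h'
  -- The two homotopies send the apex of `q` along `w₂` and `w₁'`; a square on these brings both to
  -- one apex.
  obtain ⟨n, s, t, ⟨e⟩⟩ := hJ.exists_square w₂ w₁'
  exact homotopic_iff.2 ⟨n, w₁ ≫ s, w₂' ≫ t,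
    postIso α s ≪≫ whiskerLeftIso q.u e ≪≫ postIso α' t,
    postIso β s ≪≫ whiskerLeftIso q.v e ≪≫ postIso β' t,
    (transports_postIso h s).trans ((Transports.whiskerLeft q.ξ e.hom).trans
      (transports_postIso h' t))⟩

theorem homotopic_equivalence (hJ : IsFilteredBicat J) :
    Equivalence (Homotopic (X := X) (Y := Y)) :=
  ⟨.refl, .symm, .trans hJ⟩

theorem nonempty_square (hJ : IsFilteredBicat J) (p : ColimPre X Y) (q : ColimPre Y Z) :
    Nonempty (p.Square q) := by
  obtain ⟨l, f, g, ⟨γ⟩⟩ := hJ.exists_square p.v q.u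
  exact ⟨⟨l, f, g, γ⟩⟩

/-- The homotopy uses `k` on one side and an identity on the other, with right unitors as 2-cells.
It allows representatives to be moved to a common apex. -/
theorem homotopic_hat {l n : J} {u : X.base ⟶ l} {v : Y.base ⟶ l}
    (ξ : (F.map u).toFunctor.obj X.pt ⟶ (F.map v).toFunctor.obj Y.pt) (k : l ⟶ n) :
    Homotopic (X := X) (Y := Y) ⟨l, u, v, ξ⟩ ⟨n, u ≫ k, v ≫ k, hat u v k ξ⟩ :=
  homotopic_iff.2 ⟨n, k, 𝟙 n, (ρ_ _).symm, (ρ_ _).symm, (Transports.rightUnitor _).symm⟩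

theorem homotopic_of_transports {l : J} {u u' : X.base ⟶ l} {v v' : Y.base ⟶ l}
    {ξ : (F.map u).toFunctor.obj X.pt ⟶ (F.map v).toFunctor.obj Y.pt}
    {ζ : (F.map u').toFunctor.obj X.pt ⟶ (F.map v').toFunctor.obj Y.pt}
    (α : u ≅ u') (β : v ≅ v') (h : Transports α.hom β.hom ξ ζ) :
    Homotopic (X := X) (Y := Y) ⟨l, u, v, ξ⟩ ⟨l, u', v', ζ⟩ :=
  homotopic_iff.2 ⟨l, 𝟙 l, 𝟙 l, whiskerRightIso α _, whiskerRightIso β _, h.hat (𝟙 l)⟩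

/-- Premorphisms with a common middle arrow can be composed, compatibly with homotopy. -/
theorem homotopic_comp (hJ : IsFilteredBicat J) {l l' : J} {a : X.base ⟶ l} {b : Y.base ⟶ l}
    {c : Z.base ⟶ l} {a' : X.base ⟶ l'} {b' : Y.base ⟶ l'} {c' : Z.base ⟶ l'}
    {ξ : (F.map a).toFunctor.obj X.pt ⟶ (F.map b).toFunctor.obj Y.pt}
    {ζ : (F.map b).toFunctor.obj Y.pt ⟶ (F.map c).toFunctor.obj Z.pt}
    {ξ' : (F.map a').toFunctor.obj X.pt ⟶ (F.map b').toFunctor.obj Y.pt}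
    {ζ' : (F.map b').toFunctor.obj Y.pt ⟶ (F.map c').toFunctor.obj Z.pt}
    (h : Homotopic (X := X) (Y := Y) ⟨l, a, b, ξ⟩ ⟨l', a', b', ξ'⟩)
    (h' : Homotopic (X := Y) (Y := Z) ⟨l, b, c, ζ⟩ ⟨l', b', c', ζ'⟩) :
    Homotopic (X := X) (Y := Z) ⟨l, a, c, ξ ≫ ζ⟩ ⟨l', a', c', ξ' ≫ ζ'⟩ := by
  obtain ⟨m₁, w₁, w₁', α₁, β₁, h⟩ := homotopic_iff.1 h
  obtain ⟨m₂, w₂, w₂', α₂, β₂, h'⟩ := homotopic_iff.1 h'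
  dsimp only at w₁ w₁' α₁ β₁ w₂ w₂' α₂ β₂ h h'
  -- `β₁` and `α₂` are the 2-cells that the two homotopies attach to the common middle arrows `b`,
  -- `b'`; nothing makes them agree beforehand.
  obtain ⟨n, r₁, r₂, φ, φ', e⟩ := hJ.exists_amalgamation β₁ α₂
  refine homotopic_iff.2 ⟨n, w₂ ≫ r₂, w₂' ≫ r₂,
    whiskerLeftIso a φ.symm ≪≫ postIso α₁ r₁ ≪≫ whiskerLeftIso a' φ', postIso β₂ r₂, ?_⟩
  have t₁ := (Transports.whiskerLeft ξ φ.inv).trans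
    ((transports_postIso h r₁).trans (Transports.whiskerLeft ξ' φ'.hom))
  -- After transfer along `φ` and `φ'`, the first homotopy carries the same middle 2-cell as the
  -- second, so the two squares can be pasted.
  have e' : b ◁ φ.inv ≫ (postIso β₁ r₁).hom ≫ b' ◁ φ'.hom = (postIso α₂ r₂).hom := by
    rw [e, ← whiskerLeft_comp_assoc, φ.inv_hom_id, whiskerLeft_id, Category.id_comp]
  rw [e'] at t₁
  have := t₁.hcomp (transports_postIso h' r₂)
  rw [← hat_comp, ← hat_comp] at this
  exact this

theorem homotopic_comp_left {p : ColimPre X Y} {q : ColimPre Y Z} (s : p.Square q) :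
    Homotopic p ⟨s.apex, p.u ≫ s.f, p.v ≫ s.f, hat p.u p.v s.f p.ξ⟩ :=
  homotopic_hat p.ξ s.f

/-- The cell `γ` is absorbed into `q`, so that its source arrow becomes `p.v ≫ s.f`, the target
arrow of `p` pushed along `s.f`. The composite along the square is then a composite in one fibre. -/
theorem homotopic_comp_right (hJ : IsFilteredBicat J) {p : ColimPre X Y} {q : ColimPre Y Z}
    (s : p.Square q) :
    Homotopic q ⟨s.apex, p.v ≫ s.f, q.v ≫ s.g,
      cellApp F s.γ.hom Y.pt ≫ hat q.u q.v s.g q.ξ⟩ := by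
  refine (homotopic_hat q.ξ s.g).trans hJ (homotopic_of_transports s.γ.symm (Iso.refl _) ?_)
  unfold Transports
  rw [← Category.assoc (cellApp F s.γ.symm.hom _)]
  erw [cellApp_inv_hom, Category.id_comp, cellApp_id, Category.comp_id]

theorem comp_homotopic_comp (hJ : IsFilteredBicat J) {p p' : ColimPre X Y} {q q' : ColimPre Y Z}
    (hp : Homotopic p p') (hq : Homotopic q q') (s : p.Square q) (s' : p'.Square q') :
    Homotopic (p.comp q s) (p'.comp q' s') :=
  homotopic_comp hJ
    (((homotopic_comp_left s).symm.trans hJ hp).trans hJ (homotopic_comp_left s'))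
    (((homotopic_comp_right hJ s).symm.trans hJ hq).trans hJ (homotopic_comp_right hJ s'))

end ColimPre

/-! ### Composition of homotopy classes. -/

namespace ColimHom

open ColimPre

variable {X Y Z T : ColimObj F}

theorem mk_eq_mk_iff (hJ : IsFilteredBicat J) {p q : ColimPre X Y} :
    ColimHom.mk p = ColimHom.mk q ↔ Homotopic p q :=
  Quot.eq.trans (homotopic_equivalence hJ).eqvGen_iff

theorem exists_rep₂ (hJ : IsFilteredBicat J) (f : ColimHom X Y) (g : ColimHom Y Z) :
    ∃ (l : J) (a : X.base ⟶ l) (b : Y.base ⟶ l) (c : Z.base ⟶ l)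
      (ξ : (F.map a).toFunctor.obj X.pt ⟶ (F.map b).toFunctor.obj Y.pt)
      (ζ : (F.map b).toFunctor.obj Y.pt ⟶ (F.map c).toFunctor.obj Z.pt),
      f = ColimHom.mk ⟨l, a, b, ξ⟩ ∧ g = ColimHom.mk ⟨l, b, c, ζ⟩ := by
  obtain ⟨p, rfl⟩ := Quot.exists_rep f
  obtain ⟨q, rfl⟩ := Quot.exists_rep g
  obtain ⟨s⟩ := nonempty_square hJ p q
  exact ⟨s.apex, _, _, _, _, _, Quot.sound (homotopic_comp_left s),
    Quot.sound (homotopic_comp_right hJ s)⟩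

theorem exists_rep₃ (hJ : IsFilteredBicat J) (f : ColimHom X Y) (g : ColimHom Y Z)
    (h : ColimHom Z T) :
    ∃ (l : J) (a : X.base ⟶ l) (b : Y.base ⟶ l) (c : Z.base ⟶ l) (d : T.base ⟶ l)
      (ξ : (F.map a).toFunctor.obj X.pt ⟶ (F.map b).toFunctor.obj Y.pt)
      (ζ : (F.map b).toFunctor.obj Y.pt ⟶ (F.map c).toFunctor.obj Z.pt)
      (θ : (F.map c).toFunctor.obj Z.pt ⟶ (F.map d).toFunctor.obj T.pt),
      f = ColimHom.mk ⟨l, a, b, ξ⟩ ∧ g = ColimHom.mk ⟨l, b, c, ζ⟩ ∧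
        h = ColimHom.mk ⟨l, c, d, θ⟩ := by
  obtain ⟨l, a, b, c, ξ, ζ, rfl, rfl⟩ := exists_rep₂ hJ f g
  obtain ⟨q, rfl⟩ := Quot.exists_rep h
  obtain ⟨s⟩ := nonempty_square hJ (X := Y) (Y := Z) ⟨l, b, c, ζ⟩ q
  -- `f` and `g` already share apex and middle arrow, and pushing both along `s.f` preserves this.
  exact ⟨s.apex, _, _, _, _, _, _, _, Quot.sound (homotopic_hat ξ s.f),
    Quot.sound (homotopic_hat ζ s.f), Quot.sound (homotopic_comp_right hJ s)⟩

/-- Composition of homotopy classes, by a choice of representatives and of a square. -/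
noncomputable def comp (hJ : IsFilteredBicat J) (f : ColimHom X Y) (g : ColimHom Y Z) :
    ColimHom X Z :=
  ColimHom.mk (f.out.comp g.out (nonempty_square hJ f.out g.out).some)

theorem comp_mk (hJ : IsFilteredBicat J) (p : ColimPre X Y) (q : ColimPre Y Z) (s : p.Square q) :
    comp hJ (ColimHom.mk p) (ColimHom.mk q) = ColimHom.mk (p.comp q s) :=
  Quot.sound (comp_homotopic_comp hJ ((mk_eq_mk_iff hJ).1 (Quot.out_eq _))
    ((mk_eq_mk_iff hJ).1 (Quot.out_eq _)) _ _)

/-- The identity square may be used when the middle arrow is shared. Through this formula the unit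
and associativity laws come from those of `F l`. -/
theorem comp_mk_mk (hJ : IsFilteredBicat J) {l : J} {a : X.base ⟶ l} {b : Y.base ⟶ l}
    {c : Z.base ⟶ l} (ξ : (F.map a).toFunctor.obj X.pt ⟶ (F.map b).toFunctor.obj Y.pt)
    (ζ : (F.map b).toFunctor.obj Y.pt ⟶ (F.map c).toFunctor.obj Z.pt) :
    comp hJ (ColimHom.mk ⟨l, a, b, ξ⟩) (ColimHom.mk ⟨l, b, c, ζ⟩) =
      ColimHom.mk ⟨l, a, c, ξ ≫ ζ⟩ := by
  let s : Square (X := X) (Y := Y) (Z := Z) ⟨l, a, b, ξ⟩ ⟨l, b, c, ζ⟩ :=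
    ⟨l, 𝟙 l, 𝟙 l, Iso.refl _⟩
  rw [comp_mk hJ _ _ s]
  exact Quot.sound (homotopic_comp hJ (homotopic_comp_left s).symm (homotopic_comp_right hJ s).symm)

theorem mk_id_eq {l : J} (a : X.base ⟶ l) :
    ColimHom.mk (X := X) (Y := X) ⟨l, a, a, 𝟙 _⟩ = ColimHom.mk (ColimPre.id X) := by
  symm
  refine Quot.sound (homotopic_iff.2 ⟨l, a, 𝟙 l, λ_ a ≪≫ (ρ_ a).symm, λ_ a ≪≫ (ρ_ a).symm, ?_⟩)
  unfold Transports
  erw [hat_id, hat_id, Category.id_comp, Category.comp_id]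
  rfl

end ColimHom

/-- The category `Colim F`. -/
noncomputable def colimCategory (F : J ⥤ᵖ Cat.{v', u'}) (hJ : IsFilteredBicat J) :
    ColimCategory F where
  comp := ColimHom.comp hJ
  comp_mk := ColimHom.comp_mk hJ
  id_comp f := by
    obtain ⟨p, rfl⟩ := Quot.exists_rep f
    -- The identity is represented over `p.u`, so that it shares apex and middle arrow with `p`.
    rw [← ColimHom.mk_id_eq p.u]
    exact (ColimHom.comp_mk_mk hJ _ _).trans (by rw [Category.id_comp]; rfl)
  comp_id f := by
    obtain ⟨p, rfl⟩ := Quot.exists_rep f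
    rw [← ColimHom.mk_id_eq p.v]
    exact (ColimHom.comp_mk_mk hJ _ _).trans (by rw [Category.comp_id]; rfl)
  assoc f g h := by
    obtain ⟨l, a, b, c, d, ξ, ζ, θ, rfl, rfl, rfl⟩ := ColimHom.exists_rep₃ hJ f g h
    simp only [ColimHom.comp_mk_mk, Category.assoc]

end Colim

/-! ### The universal property of the explicit colimit -/

section Universal

variable {J : Type u₁} [Bicategory.{w', v₁} J] {F : J ⥤ᵖ Cat.{v', u'}}
  {hJ : IsFilteredBicat J}

open ColimPre (hat)

variable (F hJ) in
/-- The category `Colim F` of a diagram indexed by a filtered bicategory. -/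
abbrev ColimCat := (colimCategory F hJ).Carrier

/-- The object `(j, x)` of `Colim F`. -/
abbrev ColimCat.pair (j : J) (x : F.obj j) : ColimCat F hJ := (⟨j, x⟩ : ColimObj F)

/-! ### Calculus of represented arrows in `Colim F`. -/

namespace ColimCat

variable {i j k l n : J} {x : F.obj i} {y : F.obj j} {z : F.obj k}

/-- The arrow of `Colim F` represented by a premorphism. -/
def homMk (a : i ⟶ l) (b : j ⟶ l)
    (ξ : (F.map a).toFunctor.obj x ⟶ (F.map b).toFunctor.obj y) :
    (pair i x : ColimCat F hJ) ⟶ pair j y :=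
  ColimHom.mk (X := ⟨i, x⟩) (Y := ⟨j, y⟩) ⟨l, a, b, ξ⟩

theorem hom_induction {P : ∀ {X Y : ColimCat F hJ}, (X ⟶ Y) → Prop}
    (h : ∀ {i j l : J} {x : F.obj i} {y : F.obj j} (a : i ⟶ l) (b : j ⟶ l)
      (ξ : (F.map a).toFunctor.obj x ⟶ (F.map b).toFunctor.obj y), P (homMk (hJ := hJ) a b ξ))
    {X Y : ColimCat F hJ} (f : X ⟶ Y) : P f := by
  obtain ⟨p, rfl⟩ := Quot.exists_rep f
  exact h p.u p.v p.ξ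

theorem homMk_comp_homMk {a : i ⟶ l} {b : j ⟶ l} {c : k ⟶ l}
    (ξ : (F.map a).toFunctor.obj x ⟶ (F.map b).toFunctor.obj y)
    (ζ : (F.map b).toFunctor.obj y ⟶ (F.map c).toFunctor.obj z) :
    homMk (hJ := hJ) a b ξ ≫ homMk b c ζ = homMk a c (ξ ≫ ζ) :=
  ColimHom.comp_mk_mk hJ (X := ⟨i, x⟩) (Y := ⟨j, y⟩) (Z := ⟨k, z⟩) ξ ζ

theorem homMk_id (a : i ⟶ l) :
    homMk (hJ := hJ) a a (𝟙 ((F.map a).toFunctor.obj x)) = 𝟙 (pair i x : ColimCat F hJ) :=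
  ColimHom.mk_id_eq (X := ⟨i, x⟩) a

theorem homMk_hat {a : i ⟶ l} {b : j ⟶ l}
    (ξ : (F.map a).toFunctor.obj x ⟶ (F.map b).toFunctor.obj y) (r : l ⟶ n) :
    homMk (hJ := hJ) (a ≫ r) (b ≫ r) (hat a b r ξ) = homMk a b ξ :=
  (Quot.sound (ColimPre.homotopic_hat (X := ⟨i, x⟩) (Y := ⟨j, y⟩) ξ r)).symm

theorem homMk_eq_of_transports {a a' : i ⟶ l} {b b' : j ⟶ l} (α : a ≅ a') (β : b ≅ b')
    {ξ : (F.map a).toFunctor.obj x ⟶ (F.map b).toFunctor.obj y}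
    {ζ : (F.map a').toFunctor.obj x ⟶ (F.map b').toFunctor.obj y}
    (h : Transports α.hom β.hom ξ ζ) : homMk (hJ := hJ) a b ξ = homMk a' b' ζ :=
  Quot.sound (ColimPre.homotopic_of_transports (X := ⟨i, x⟩) (Y := ⟨j, y⟩) α β h)

/-- The image of `φ` under a leg can be computed at any later stage; this gives naturality of the
structure cells of the cocone. -/
theorem homMk_id_map {x x' : F.obj i} (φ : x ⟶ x') (a : i ⟶ l) :
    homMk (hJ := hJ) (𝟙 i) (𝟙 i) ((F.map (𝟙 i)).toFunctor.map φ) =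
      homMk a a ((F.map a).toFunctor.map φ) := by
  rw [← homMk_hat _ a]
  refine homMk_eq_of_transports (λ_ a) (λ_ a) ?_
  unfold Transports hat
  rw [cellApp_leftUnitor_hom, cellApp_leftUnitor_hom]
  simp only [Category.assoc, Cat.Hom.inv_hom_id_toNatTrans_app_assoc]
  rw [← Functor.map_comp, mapId_hom_naturality]
  erw [Functor.map_comp]

/-- Homotopies involve only invertible 2-cells, whereas `η` is arbitrary. Filteredness provides `r`
with `η ▷ r` invertible, and both sides are compared after pushing along `r`. -/
theorem homMk_id_cellApp {a b : i ⟶ j} (η : a ⟶ b) (x : F.obj i) :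
    homMk (hJ := hJ) (y := x) (𝟙 j) b
      ((F.mapId j).hom.toNatTrans.app ((F.map a).toFunctor.obj x) ≫ cellApp F η x) =
    homMk (𝟙 j) a ((F.mapId j).hom.toNatTrans.app ((F.map a).toFunctor.obj x)) := by
  obtain ⟨n, r, -, hr⟩ := hJ.exists_whiskerRight_eq_and_isIso η η
  rw [← homMk_hat _ r, ← homMk_hat ((F.mapId j).hom.toNatTrans.app _) r]
  symm
  refine homMk_eq_of_transports (Iso.refl _) (asIso (η ▷ r)) ?_
  unfold Transports
  erw [cellApp_id, Category.id_comp, hat_comp (v := a), hat_cellApp]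
  rfl

theorem homMk_id_mapId (a : i ⟶ j) (b : j ⟶ k) (x : F.obj i) :
    homMk (hJ := hJ) (y := x) (𝟙 j) a
      ((F.mapId j).hom.toNatTrans.app ((F.map a).toFunctor.obj x)) =
    homMk b (a ≫ b) ((F.mapComp a b).inv.toNatTrans.app x) := by
  rw [← homMk_hat _ b]
  refine homMk_eq_of_transports (λ_ b) (Iso.refl _) ?_
  unfold Transports hat
  rw [cellApp_leftUnitor_hom, Iso.refl_hom, cellApp_id, Category.comp_id, Category.assoc]

end ColimCat

open ColimCat

variable (F hJ) in
/-- The canonical pseudo-cocone with apex `Colim F`. -/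
noncomputable def colimCocone : CatCocone F (ColimCat F hJ) where
  leg j :=
    { obj := fun x => pair j x
      map := fun φ => homMk (𝟙 j) (𝟙 j) ((F.map (𝟙 j)).toFunctor.map φ)
      map_id := fun x => by rw [CategoryTheory.Functor.map_id, homMk_id]
      map_comp := fun φ ψ => by rw [Functor.map_comp, homMk_comp_homMk] }
  iso {i j} a := NatIso.ofComponents
    (fun x =>
      { hom := homMk (𝟙 j) a ((F.mapId j).hom.toNatTrans.app ((F.map a).toFunctor.obj x))
        inv := homMk a (𝟙 j) ((F.mapId j).inv.toNatTrans.app ((F.map a).toFunctor.obj x))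
        hom_inv_id := by
          rw [homMk_comp_homMk, Cat.Hom.hom_inv_id_toNatTrans_app, homMk_id]; rfl
        inv_hom_id := by
          rw [homMk_comp_homMk, Cat.Hom.inv_hom_id_toNatTrans_app]; exact homMk_id a })
    (fun {x y} φ => by
      change homMk (𝟙 j) (𝟙 j) _ ≫ homMk (𝟙 j) a _ = homMk (𝟙 j) a _ ≫ homMk (𝟙 i) (𝟙 i) _
      rw [homMk_id_map φ a, homMk_comp_homMk, homMk_comp_homMk, mapId_hom_naturality])
  unity i x := by
    change homMk (𝟙 i) (𝟙 i) _ = homMk (𝟙 i) (𝟙 i) _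
    rw [mapId_hom_app_map_id]
  functoriality {i j k} a b x := by
    change homMk (𝟙 k) (a ≫ b) _ = homMk (𝟙 k) (𝟙 k) _ ≫ homMk (𝟙 k) b _ ≫ homMk (𝟙 j) a _
    rw [homMk_id_mapId a b x, homMk_comp_homMk, homMk_comp_homMk]
    congr 1
    have := mapId_hom_naturality k ((F.mapComp a b).hom.toNatTrans.app x)
    erw [reassoc_of% this, Cat.Hom.hom_inv_id_toNatTrans_app, Category.comp_id]
  naturality {i j a b} η x := by
    change homMk (𝟙 j) (𝟙 j) _ ≫ homMk (𝟙 j) b _ = homMk (𝟙 j) a _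
    rw [homMk_comp_homMk, mapId_hom_naturality]
    exact homMk_id_cellApp η x

/-! ### Functors and transformations out of `Colim F`. -/

namespace CatCocone

variable {E : Type uE} [Category.{vE} E] (σ : CatCocone F E)

/-- The arrow of the apex of a pseudo-cocone induced by a premorphism. -/
def descMap {i j l : J} {x : F.obj i} {y : F.obj j} (a : i ⟶ l) (b : j ⟶ l)
    (ξ : (F.map a).toFunctor.obj x ⟶ (F.map b).toFunctor.obj y) :
    (σ.leg i).obj x ⟶ (σ.leg j).obj y :=
  (σ.iso a).inv.app x ≫ (σ.leg l).map ξ ≫ (σ.iso b).hom.app y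

theorem iso_comp_inv_app {i j k : J} (a : i ⟶ j) (b : j ⟶ k) (x : F.obj i) :
    (σ.iso (a ≫ b)).inv.app x = (σ.iso a).inv.app x ≫
      (σ.iso b).inv.app ((F.map a).toFunctor.obj x) ≫
        (σ.leg k).map ((F.mapComp a b).inv.toNatTrans.app x) := by
  rw [← cancel_epi ((σ.iso (a ≫ b)).hom.app x), Iso.hom_inv_id_app, σ.functoriality]
  simp only [Category.assoc, Iso.hom_inv_id_app_assoc]
  rw [← Functor.map_comp, Cat.Hom.hom_inv_id_toNatTrans_app]
  exact ((σ.leg k).map_id _).symm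

/-- Functoriality of `σ` splits the cells at `a ≫ r` and `b ≫ r`, the constraints of `F` cancel, and
naturality of the cell at `r` brings `ξ` back to stage `l`. -/
theorem descMap_hat {i j l n : J} {x : F.obj i} {y : F.obj j} {a : i ⟶ l} {b : j ⟶ l}
    (ξ : (F.map a).toFunctor.obj x ⟶ (F.map b).toFunctor.obj y) (r : l ⟶ n) :
    σ.descMap (a ≫ r) (b ≫ r) (hat a b r ξ) = σ.descMap a b ξ := by
  unfold descMap hat
  rw [iso_comp_inv_app, σ.functoriality]
  have h₁ := (σ.leg n).map_comp ((F.mapComp a r).inv.toNatTrans.app x)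
    ((F.mapComp a r).hom.toNatTrans.app x)
  have h₂ := (σ.leg n).map_comp ((F.mapComp b r).inv.toNatTrans.app y)
    ((F.mapComp b r).hom.toNatTrans.app y)
  rw [Cat.Hom.inv_hom_id_toNatTrans_app, CategoryTheory.Functor.map_id] at h₁ h₂
  have h₃ := (σ.iso r).hom.naturality ξ
  simp only [Category.assoc, Functor.map_comp, ← reassoc_of% h₁, ← reassoc_of% h₂]
  erw [reassoc_of% h₃, Iso.inv_hom_id_app_assoc]

theorem iso_inv_naturality {i j : J} {a b : i ⟶ j} (η : a ⟶ b) (x : F.obj i) :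
    (σ.iso a).inv.app x ≫ (σ.leg j).map (cellApp F η x) = (σ.iso b).inv.app x := by
  rw [← cancel_mono ((σ.iso b).hom.app x), Category.assoc, σ.naturality, Iso.inv_hom_id_app,
    Iso.inv_hom_id_app]

theorem descMap_eq_of_transports {i j l : J} {x : F.obj i} {y : F.obj j} {a a' : i ⟶ l}
    {b b' : j ⟶ l} {α : a ⟶ a'} {β : b ⟶ b'}
    {ξ : (F.map a).toFunctor.obj x ⟶ (F.map b).toFunctor.obj y}
    {ζ : (F.map a').toFunctor.obj x ⟶ (F.map b').toFunctor.obj y}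
    (h : Transports α β ξ ζ) : σ.descMap a b ξ = σ.descMap a' b' ζ := by
  unfold descMap
  rw [← σ.naturality β y, ← σ.iso_inv_naturality α x, Category.assoc,
    ← Functor.map_comp_assoc, ← Functor.map_comp_assoc, h]

theorem descMap_eq_of_homotopic {X Y : ColimObj F} {p q : ColimPre X Y}
    (h : ColimPre.Homotopic p q) : σ.descMap p.u p.v p.ξ = σ.descMap q.u q.v q.ξ := by
  obtain ⟨l, w₁, w₂, α, β, h⟩ := ColimPre.homotopic_iff.1 h
  rw [← σ.descMap_hat p.ξ w₁, σ.descMap_eq_of_transports h, σ.descMap_hat]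

variable (hJ) in
/-- The functor out of `Colim F` induced by a pseudo-cocone. -/
noncomputable def desc : ColimCat F hJ ⥤ E where
  obj X := (σ.leg X.base).obj X.pt
  map {X Y} := Quot.lift (fun p : ColimPre (F := F) X Y => σ.descMap p.u p.v p.ξ)
    (fun _ _ h => σ.descMap_eq_of_homotopic h)
  map_id X := by
    change σ.descMap (𝟙 X.base) (𝟙 X.base) (𝟙 _) = 𝟙 _
    unfold descMap
    erw [CategoryTheory.Functor.map_id, Category.id_comp, Iso.inv_hom_id_app]
  map_comp {X Y Z} f g := by
    -- With a shared middle arrow `b`, the cell of `σ` at `b` and its inverse cancel.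
    obtain ⟨l, a, b, c, ξ, ζ, rfl, rfl⟩ := ColimHom.exists_rep₂ hJ f g
    refine (congrArg _ (ColimHom.comp_mk_mk hJ ξ ζ)).trans ?_
    change σ.descMap a c (ξ ≫ ζ) = σ.descMap a b ξ ≫ σ.descMap b c ζ
    simp only [descMap, Functor.map_comp, Category.assoc, Iso.hom_inv_id_app_assoc]
theorem ext_of_leg {σ τ : CatCocone F E} (h : ∀ j, σ.leg j = τ.leg j)
    (h' : ∀ {i j : J} (a : i ⟶ j) (x : F.obj i), (σ.iso a).hom.app x =
      eqToHom (by rw [h]) ≫ (τ.iso a).hom.app x ≫ eqToHom (by rw [h])) : σ = τ := by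
  obtain ⟨leg, iso, _, _, _⟩ := σ
  obtain ⟨leg', iso', _, _, _⟩ := τ
  obtain rfl : leg = leg' := funext h
  have : @iso = @iso' := by
    funext i j a
    ext x
    simpa using h' a x
  subst this
  rfl

theorem desc_map_homMk {i j l : J} {x : F.obj i} {y : F.obj j} (a : i ⟶ l) (b : j ⟶ l)
    (ξ : (F.map a).toFunctor.obj x ⟶ (F.map b).toFunctor.obj y) :
    (σ.desc hJ).map (homMk a b ξ) = σ.descMap a b ξ :=
  rfl

theorem descMap_id_map {i : J} {x y : F.obj i} (φ : x ⟶ y) :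
    σ.descMap (𝟙 i) (𝟙 i) ((F.map (𝟙 i)).toFunctor.map φ) = (σ.leg i).map φ := by
  have h := (σ.iso (𝟙 i)).hom.naturality φ
  exact (congrArg _ h).trans (Iso.inv_hom_id_app_assoc _ _ _)

theorem descMap_id_mapId {i j : J} (a : i ⟶ j) (x : F.obj i) :
    σ.descMap (𝟙 j) a ((F.mapId j).hom.toNatTrans.app ((F.map a).toFunctor.obj x)) =
      (σ.iso a).hom.app x := by
  unfold descMap
  erw [← σ.unity, Iso.inv_hom_id_app_assoc]

theorem push_descMap {E' : Type u} [Category.{v} E'] (G : E ⥤ E') {i j l : J} {x : F.obj i}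
    {y : F.obj j} (a : i ⟶ l) (b : j ⟶ l)
    (ξ : (F.map a).toFunctor.obj x ⟶ (F.map b).toFunctor.obj y) :
    (σ.push G).descMap a b ξ = G.map (σ.descMap a b ξ) := by
  simp [descMap, push]

/-- A modification commutes with the structure cells, and its components are natural. This will be
naturality of the transformation it induces on `Colim F`. -/
theorem Hom.descMap_comp_app {σ τ : CatCocone F E} (s : σ ⟶ τ) {i j l : J} {x : F.obj i}
    {y : F.obj j} (a : i ⟶ l) (b : j ⟶ l)
    (ξ : (F.map a).toFunctor.obj x ⟶ (F.map b).toFunctor.obj y) :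
    σ.descMap a b ξ ≫ (s.app j).app y = (s.app i).app x ≫ τ.descMap a b ξ := by
  have h : (σ.iso a).inv.app x ≫ (s.app l).app _ = (s.app i).app x ≫ (τ.iso a).inv.app x := by
    rw [← cancel_epi ((σ.iso a).hom.app x), Iso.hom_inv_id_app_assoc, ← Category.assoc, s.comm,
      Category.assoc, Iso.hom_inv_id_app]
    exact (Category.comp_id _).symm
  unfold descMap
  rw [Category.assoc, Category.assoc, s.comm]
  erw [NatTrans.naturality_assoc, reassoc_of% h]

/-- Every arrow of `Colim F` is thus built from structure cells and images under legs, which gives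
uniqueness in the universal property. -/
theorem colimCocone_descMap {i j l : J} {x : F.obj i} {y : F.obj j} (a : i ⟶ l) (b : j ⟶ l)
    (ξ : (F.map a).toFunctor.obj x ⟶ (F.map b).toFunctor.obj y) :
    (colimCocone F hJ).descMap a b ξ = homMk a b ξ := by
  change homMk a (𝟙 l) _ ≫ homMk (𝟙 l) (𝟙 l) _ ≫ homMk (𝟙 l) b _ = _
  rw [homMk_comp_homMk, homMk_comp_homMk, mapId_hom_naturality]
  erw [Cat.Hom.inv_hom_id_toNatTrans_app_assoc]

theorem push_desc : (colimCocone F hJ).push (σ.desc hJ) = σ := by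
  refine ext_of_leg (fun j => CategoryTheory.Functor.ext (fun x => rfl) fun x y φ => ?_)
    fun {i j} a x => ?_
  · exact (σ.descMap_id_map φ).trans
      ((Category.id_comp _).trans (Category.comp_id _)).symm
  · refine (Category.id_comp _).trans ((σ.descMap_id_mapId a x).trans ?_)
    exact ((Category.id_comp _).trans (Category.comp_id _)).symm

theorem desc_push (G : ColimCat F hJ ⥤ E) : ((colimCocone F hJ).push G).desc hJ = G := by
  refine CategoryTheory.Functor.ext (fun X => rfl) fun X Y f => ?_
  refine hom_induction (P := fun {X Y} f =>
    (((colimCocone F hJ).push G).desc hJ).map f = 𝟙 (G.obj X) ≫ G.map f ≫ 𝟙 (G.obj Y)) ?_ f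
  intro i j l x y a b ξ
  rw [desc_map_homMk, push_descMap, colimCocone_descMap]
  exact ((Category.id_comp _).trans (Category.comp_id _)).symm

end CatCocone

theorem colimCocone_isPseudoColimit :
    CatCocone.IsPseudoColimit.{vE, uE} (colimCocone F hJ) := by
  intro E _
  refine ⟨⟨fun G G' h => ?_, fun σ => ⟨σ.desc hJ, σ.push_desc⟩⟩,
    fun G G' => ⟨fun t t' h => ?_, fun s => ?_⟩⟩
  · rw [← CatCocone.desc_push G, ← CatCocone.desc_push G']
    exact congrArg (CatCocone.desc hJ) h
  · ext X
    exact congrArg (fun s : CatCocone.Hom _ _ => (s.app X.base).app X.pt) h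
  -- An object of `Colim F` is a pair, so the component at `(j, x)` must be that of `s.app j` at
  -- `x`.
  · refine ⟨{ app := fun X => (s.app X.base).app X.pt, naturality := fun X Y f => ?_ }, rfl⟩
    refine hom_induction (P := fun {X Y} f => G.map f ≫ (s.app Y.base).app Y.pt =
      (s.app X.base).app X.pt ≫ G'.map f) ?_ f
    intro i j l x y a b ξ
    have h := CatCocone.Hom.descMap_comp_app s a b ξ
    erw [CatCocone.push_descMap, CatCocone.push_descMap, CatCocone.colimCocone_descMap] at h
    exact h

end Universal

/-! ### Comparison with the bicategory of fractions -/

section Comparison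

variable {B : Type u} [Bicategory.{w, v} B] {W : ∀ ⦃X Y : B⦄, (X ⟶ Y) → Prop} {A T : B}

open ColimPre (hat)

theorem homDiagram_cellApp {a b : (WSlice W A)ᵒᵖ} {u v : a ⟶ b} (η : u ⟶ v)
    (x : (homDiagram W A T).obj a) :
    cellApp (homDiagram W A T) η x = η.unop2.cell ▷ (x : a.unop.dom ⟶ T) :=
  rfl

theorem homDiagram_mapComp_hom {a b c : (WSlice W A)ᵒᵖ} (u : a ⟶ b) (v : b ⟶ c)
    (x : (homDiagram W A T).obj a) :
    ((homDiagram W A T).mapComp u v).hom.toNatTrans.app x =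
      (α_ v.unop.hom u.unop.hom (x : a.unop.dom ⟶ T)).hom := by
  -- `forget` is strict and contributes only a whiskered identity; the associator comes from the
  -- representable.
  change 𝟙 (v.unop.hom ≫ u.unop.hom) ▷ (x : a.unop.dom ⟶ T) ≫ _ = _
  erw [id_whiskerRight]
  exact Category.id_comp _

theorem homDiagram_mapComp_inv {a b c : (WSlice W A)ᵒᵖ} (u : a ⟶ b) (v : b ⟶ c)
    (x : (homDiagram W A T).obj a) :
    ((homDiagram W A T).mapComp u v).inv.toNatTrans.app x =
      (α_ v.unop.hom u.unop.hom (x : a.unop.dom ⟶ T)).inv := by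
  change _ ≫ 𝟙 (v.unop.hom ≫ u.unop.hom) ▷ (x : a.unop.dom ⟶ T) = _
  erw [id_whiskerRight]
  exact Category.comp_id _

theorem homDiagram_hat {a b c d : (WSlice W A)ᵒᵖ} (u : a ⟶ c) (v : b ⟶ c) (k : c ⟶ d)
    {x : (homDiagram W A T).obj a} {y : (homDiagram W A T).obj b}
    (ξ : ((homDiagram W A T).map u).toFunctor.obj x ⟶ ((homDiagram W A T).map v).toFunctor.obj y) :
    hat u v k ξ = (α_ k.unop.hom u.unop.hom (x : a.unop.dom ⟶ T)).hom ≫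
      k.unop.hom ◁ (ξ : u.unop.hom ≫ (x : a.unop.dom ⟶ T) ⟶ v.unop.hom ≫ (y : b.unop.dom ⟶ T)) ≫
        (α_ k.unop.hom v.unop.hom (y : b.unop.dom ⟶ T)).inv := by
  unfold hat
  rw [homDiagram_mapComp_hom, homDiagram_mapComp_inv]
  rfl

namespace WSlice

/-- The underlying invertible 2-cell of an invertible 2-cell of the opposite of the slice. -/
def cellIso {X Y : (WSlice W A)ᵒᵖ} {f g : X ⟶ Y} (e : f ≅ g) : f.unop.hom ≅ g.unop.hom where
  hom := e.hom.unop2.cell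
  inv := e.inv.unop2.cell
  hom_inv_id := congrArg (fun η => η.unop2.cell) e.hom_inv_id
  inv_hom_id := congrArg (fun η => η.unop2.cell) e.inv_hom_id

theorem cellIso_comm {X Y : (WSlice W A)ᵒᵖ} {f g : X ⟶ Y} (e : f ≅ g) :
    f.unop.iso.hom ≫ (cellIso e).hom ▷ X.unop.arr = g.unop.iso.hom :=
  e.hom.unop2.comm

end WSlice

/-! ### Pasting identities between 2-cells over `A` and equations of quintuples. -/

section Pasting

variable {a b c d e t : B} {h : e ⟶ a} {k : e ⟶ b} {u : a ⟶ c} {v : a ⟶ d} {u' : b ⟶ c}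
  {v' : b ⟶ d} {x : c ⟶ t} {y : d ⟶ t} {p : a ⟶ t} {q : b ⟶ t} {l : e ⟶ t}

/-- `hγ` and `hδ` say that `γ` and `δ` are 2-cells over `A`. Solving them for `γ ▷ x` and `δ ▷ y`,
both involve the same factor `s⁻¹` followed by `r`. -/
theorem paste_eq_of_slice (αu : p ≅ u ≫ x) (αv : p ≅ v ≫ y) (αu' : q ≅ u' ≫ x)
    (αv' : q ≅ v' ≫ y) (s : l ≅ h ≫ p) (r : l ≅ k ≫ q) (γ : h ≫ u ≅ k ≫ u')
    (δ : h ≫ v ≅ k ≫ v')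
    (hγ : (s.hom ≫ h ◁ αu.hom ≫ (α_ h u x).inv) ≫ γ.hom ▷ x =
      r.hom ≫ k ◁ αu'.hom ≫ (α_ k u' x).inv)
    (hδ : (s.hom ≫ h ◁ αv.hom ≫ (α_ h v y).inv) ≫ δ.hom ▷ y =
      r.hom ≫ k ◁ αv'.hom ≫ (α_ k v' y).inv) :
    γ.hom ▷ x ≫ (α_ k u' x).hom ≫ k ◁ (αu'.symm ≪≫ αv').hom =
      (α_ h u x).hom ≫ h ◁ (αu.symm ≪≫ αv).hom ≫ (α_ h v y).inv ≫ δ.hom ▷ y ≫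
        (α_ k v' y).hom := by
  have hγ' : γ.hom ▷ x = (α_ h u x).hom ≫ h ◁ αu.inv ≫ s.inv ≫ r.hom ≫ k ◁ αu'.hom ≫
      (α_ k u' x).inv := by
    rw [← hγ]; simp
  have hδ' : δ.hom ▷ y = (α_ h v y).hom ≫ h ◁ αv.inv ≫ s.inv ≫ r.hom ≫ k ◁ αv'.hom ≫
      (α_ k v' y).inv := by
    rw [← hδ]; simp
  rw [hγ', hδ']
  simp

theorem slice_eq_left (αu : p ≅ u ≫ x) (αu' : q ≅ u' ≫ x) (s : l ≅ (h ≫ u) ≫ x)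
    (γ : h ≫ u ≅ k ≫ u') :
    ((s ≪≫ α_ h u x ≪≫ whiskerLeftIso h αu.symm).hom ≫ h ◁ αu.hom ≫ (α_ h u x).inv) ≫ γ.hom ▷ x =
      (s ≪≫ whiskerRightIso γ x ≪≫ α_ k u' x ≪≫ whiskerLeftIso k αu'.symm).hom ≫ k ◁ αu'.hom ≫
        (α_ k u' x).inv := by
  simp

/-- Converse direction: once the 2-cell on `k` is chosen so that `γ` lies over `A`, the equation
`hp` makes `δ` lie over `A` as well. -/
theorem slice_eq_right (αu : p ≅ u ≫ x) (αv : p ≅ v ≫ y) (αu' : q ≅ u' ≫ x)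
    (αv' : q ≅ v' ≫ y) (s : l ≅ (h ≫ u) ≫ x) (γ : h ≫ u ≅ k ≫ u') (δ : h ≫ v ≅ k ≫ v')
    (hp : γ.hom ▷ x ≫ (α_ k u' x).hom ≫ k ◁ (αu'.symm ≪≫ αv').hom =
      (α_ h u x).hom ≫ h ◁ (αu.symm ≪≫ αv).hom ≫ (α_ h v y).inv ≫ δ.hom ▷ y ≫
        (α_ k v' y).hom) :
    ((s ≪≫ α_ h u x ≪≫ whiskerLeftIso h αu.symm).hom ≫ h ◁ αv.hom ≫ (α_ h v y).inv) ≫ δ.hom ▷ y =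
      (s ≪≫ whiskerRightIso γ x ≪≫ α_ k u' x ≪≫ whiskerLeftIso k αu'.symm).hom ≫ k ◁ αv'.hom ≫
        (α_ k v' y).inv := by
  have := congrArg (fun θ => s.hom ≫ θ ≫ (α_ k v' y).inv) hp
  simpa using this.symm

theorem slice_eq_of_square (αv : p ≅ v ≫ y) (αv' : q ≅ v' ≫ y) (s : l ≅ h ≫ p)
    (δ : h ≫ v ≅ k ≫ v') :
    (s.hom ≫ h ◁ αv.hom ≫ (α_ h v y).inv) ≫ δ.hom ▷ y =
      (s ≪≫ whiskerLeftIso h αv ≪≫ (α_ h v y).symm ≪≫ whiskerRightIso δ y ≪≫ α_ k v' y ≪≫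
        whiskerLeftIso k αv'.symm).hom ≫ k ◁ αv'.hom ≫ (α_ k v' y).inv := by
  simp

/-- The 2-cell condition on a square determines the composite of the quintuples along it. -/
theorem comp_iso_eq_of_slice {f : B} {v'' : b ⟶ f} {z : f ⟶ t} (αu : p ≅ u ≫ x)
    (αv : p ≅ v ≫ y) (αv' : q ≅ v' ≫ y) (αz : q ≅ v'' ≫ z) (s : l ≅ h ≫ p) (r : l ≅ k ≫ q)
    (δ : h ≫ v ≅ k ≫ v')
    (hδ : (s.hom ≫ h ◁ αv.hom ≫ (α_ h v y).inv) ≫ δ.hom ▷ y =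
      r.hom ≫ k ◁ αv'.hom ≫ (α_ k v' y).inv) :
    (s ≪≫ whiskerLeftIso h αu ≪≫ (α_ h u x).symm).symm ≪≫
        (r ≪≫ whiskerLeftIso k αz ≪≫ (α_ k v'' z).symm) =
      α_ h u x ≪≫ whiskerLeftIso h (αu.symm ≪≫ αv) ≪≫ (α_ h v y).symm ≪≫ whiskerRightIso δ y ≪≫
        α_ k v' y ≪≫ whiskerLeftIso k (αv'.symm ≪≫ αz) ≪≫ (α_ k v'' z).symm := by
  have hδ' : δ.hom ▷ y = (α_ h v y).hom ≫ h ◁ αv.inv ≫ s.inv ≫ r.hom ≫ k ◁ αv'.hom ≫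
      (α_ k v' y).inv := by
    rw [← hδ]; simp
  ext
  simp only [Iso.trans_hom, Iso.symm_hom, whiskerRightIso_hom, whiskerLeftIso_hom, hδ']
  simp

theorem paste_eq_iff (γ : h ≫ u ⟶ k ≫ u') (δ : h ≫ v ⟶ k ≫ v') (ξ : u ≫ x ⟶ v ≫ y)
    (ζ : u' ≫ x ⟶ v' ≫ y) :
    γ ▷ x ≫ (α_ k u' x).hom ≫ k ◁ ζ =
        (α_ h u x).hom ≫ h ◁ ξ ≫ (α_ h v y).inv ≫ δ ▷ y ≫ (α_ k v' y).hom ↔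
      ((α_ h u x).hom ≫ h ◁ ξ ≫ (α_ h v y).inv) ≫ δ ▷ y =
        γ ▷ x ≫ (α_ k u' x).hom ≫ k ◁ ζ ≫ (α_ k v' y).inv := by
  rw [← cancel_mono (α_ k v' y).inv]
  simp only [Category.assoc, Iso.hom_inv_id, Category.comp_id]
  exact eq_comm

end Pasting

/-! ### Premorphisms, homotopies and squares against their counterparts for fractions. -/

namespace ColimPre

variable {X Y Z : ColimObj (homDiagram W A T)}

theorem Homotopic.toFrac {p q : ColimPre X Y} (H : Homotopic p q) :
    FracPre.Homotopic p.toFrac q.toFrac := by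
  obtain ⟨l, w₁, w₂, α, β, h⟩ := homotopic_iff.1 H
  have hα := WSlice.cellIso_comm α
  have hβ := WSlice.cellIso_comm β
  refine ⟨⟨l.unop.dom, w₁.unop.hom, w₂.unop.hom, WSlice.cellIso α, WSlice.cellIso β,
    ⟨l.unop.arr, l.unop.mem, ⟨(p.u ≫ w₁).unop.iso⟩⟩, ?_, ?_⟩⟩
  · exact paste_eq_of_slice p.u.unop.iso p.v.unop.iso q.u.unop.iso q.v.unop.iso w₁.unop.iso
      w₂.unop.iso (WSlice.cellIso α) (WSlice.cellIso β) hα hβ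
  · unfold Transports at h
    rw [homDiagram_hat, homDiagram_hat, homDiagram_cellApp, homDiagram_cellApp] at h
    exact (paste_eq_iff _ _ _ _).2 h

theorem homotopic_of_toFrac {p q : ColimPre X Y} (H : FracPre.Homotopic p.toFrac q.toFrac) :
    Homotopic p q := by
  obtain ⟨l, h, k, γ, δ, ⟨w, hw, ⟨e⟩⟩, hα, hξ⟩ := H
  let L : WSlice W A := ⟨l, w, hw⟩
  -- The witness `e` supplies the 2-cell of `w₁`. That of `w₂` is routed through `γ`, so that `γ`
  -- lies over `A` by construction.
  let w₁ : L ⟶ p.apex.unop :=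
    ⟨h, e ≪≫ α_ h p.u.unop.hom X.base.unop.arr ≪≫ whiskerLeftIso h p.u.unop.iso.symm⟩
  let w₂ : L ⟶ q.apex.unop :=
    ⟨k, e ≪≫ whiskerRightIso γ X.base.unop.arr ≪≫ α_ k q.u.unop.hom X.base.unop.arr ≪≫
      whiskerLeftIso k q.u.unop.iso.symm⟩
  let α : w₁ ≫ p.u.unop ≅ w₂ ≫ q.u.unop :=
    WSlice.isoMk γ (slice_eq_left p.u.unop.iso q.u.unop.iso e γ)
  let β : w₁ ≫ p.v.unop ≅ w₂ ≫ q.v.unop :=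
    WSlice.isoMk δ (slice_eq_right p.u.unop.iso p.v.unop.iso
    q.u.unop.iso q.v.unop.iso e γ δ hα)
  refine homotopic_iff.2 ⟨op L, w₁.op, w₂.op, α.op2, β.op2, ?_⟩
  unfold Transports
  rw [homDiagram_hat, homDiagram_hat, homDiagram_cellApp, homDiagram_cellApp]
  exact (paste_eq_iff _ _ _ _).1 hξ

/-- Take the membership witness `e` as `α_u` and `e` followed by `α` as `α_v`; then `α_v α_u⁻¹ = α`.
Equality on the nose allows substitution of quintuples by premorphisms later. -/
theorem exists_toFrac_eq (P : FracPre X.toFrac Y.toFrac) : ∃ p : ColimPre X Y, p.toFrac = P := by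
  obtain ⟨C, u, v, α, ξ, ⟨w, hw, ⟨e⟩⟩⟩ := P
  let L : WSlice W A := ⟨C, w, hw⟩
  let u' : L ⟶ X.base.unop := ⟨u, e⟩
  let v' : L ⟶ Y.base.unop := ⟨v, e ≪≫ α⟩
  refine ⟨⟨op L, u'.op, v'.op, ξ⟩, ?_⟩
  have : e.symm ≪≫ e ≪≫ α = α := by simp
  change FracPre.mk C u v (e.symm ≪≫ e ≪≫ α) ξ _ = _
  rw [this]

/-- The square of quintuples underlying a square of premorphisms. -/
def Square.toFrac {p : ColimPre X Y} {q : ColimPre Y Z} (s : p.Square q) :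
    p.toFrac.Square q.toFrac where
  apex := s.apex.unop.dom
  h := s.f.unop.hom
  g := s.g.unop.hom
  γ := WSlice.cellIso s.γ
  mem := ⟨s.apex.unop.arr, s.apex.unop.mem, ⟨(p.u ≫ s.f).unop.iso⟩⟩

theorem exists_square_toFrac_eq {p : ColimPre X Y} {q : ColimPre Y Z}
    (S : p.toFrac.Square q.toFrac) : ∃ s : p.Square q, s.toFrac = S := by
  obtain ⟨D, h, g, γ, ⟨w, hw, ⟨e⟩⟩⟩ := S
  let L : WSlice W A := ⟨D, w, hw⟩
  let f' : L ⟶ p.apex.unop :=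
    ⟨h, e ≪≫ α_ h p.u.unop.hom X.base.unop.arr ≪≫ whiskerLeftIso h p.u.unop.iso.symm⟩
  -- The 2-cell of `g'` is obtained by solving the condition that `γ` lie over `A`.
  let g' : L ⟶ q.apex.unop :=
    ⟨g, f'.iso ≪≫ whiskerLeftIso h p.v.unop.iso ≪≫ (α_ h p.v.unop.hom Y.base.unop.arr).symm ≪≫
      whiskerRightIso γ Y.base.unop.arr ≪≫ α_ g q.u.unop.hom Y.base.unop.arr ≪≫
        whiskerLeftIso g q.u.unop.iso.symm⟩
  let γ' : f' ≫ p.v.unop ≅ g' ≫ q.u.unop :=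
    WSlice.isoMk γ (slice_eq_of_square p.v.unop.iso q.u.unop.iso
    f'.iso γ)
  exact ⟨⟨op L, f'.op, g'.op, γ'.op2⟩, rfl⟩

theorem toFrac_comp (p : ColimPre X Y) (q : ColimPre Y Z) (s : p.Square q) :
    (p.comp q s).toFrac = p.toFrac.comp q.toFrac s.toFrac := by
  have hα : (p.comp q s).toFrac.α = (p.toFrac.comp q.toFrac s.toFrac).α :=
    comp_iso_eq_of_slice p.u.unop.iso p.v.unop.iso q.u.unop.iso q.v.unop.iso s.f.unop.iso
      s.g.unop.iso (WSlice.cellIso s.γ) (WSlice.cellIso_comm s.γ)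
  have hξ : (p.comp q s).toFrac.ξ = (p.toFrac.comp q.toFrac s.toFrac).ξ := by
    change hat p.u p.v s.f p.ξ ≫ cellApp _ s.γ.hom Y.pt ≫ hat q.u q.v s.g q.ξ = _
    rw [homDiagram_hat, homDiagram_hat, homDiagram_cellApp]
    erw [Category.assoc, Category.assoc]
    rfl
  -- The apex and the two arrows agree definitionally; only the fields `α` and `ξ` have to be
  -- rewritten.
  change FracPre.mk (p.toFrac.comp q.toFrac s.toFrac).apex (p.toFrac.comp q.toFrac s.toFrac).u
    (p.toFrac.comp q.toFrac s.toFrac).v (p.comp q s).toFrac.α (p.comp q s).toFrac.ξ _ = _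
  rw [hα, hξ]

end ColimPre

/-- The triple `(C, w, f)` regarded as the pair `((C, w), f)`. -/
def FracObj.toColim (X : FracObj W A T) : ColimObj (homDiagram W A T) where
  base := op ⟨X.apex, X.w, X.mem⟩
  pt := X.f

/-! ### Homotopy and composition of quintuples, transported from premorphisms. -/

namespace FracPre

variable {X Y Z : FracObj W A T}

theorem homotopic_equivalence (hW : IsCofilteredBicat (WSlice W A)) :
    Equivalence (Homotopic (X := X) (Y := Y)) where
  refl P := by
    obtain ⟨p, rfl⟩ := ColimPre.exists_toFrac_eq (X := X.toColim) (Y := Y.toColim) P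
    exact (ColimPre.Homotopic.refl p).toFrac
  symm {P Q} h := by
    obtain ⟨p, rfl⟩ := ColimPre.exists_toFrac_eq (X := X.toColim) (Y := Y.toColim) P
    obtain ⟨q, rfl⟩ := ColimPre.exists_toFrac_eq (X := X.toColim) (Y := Y.toColim) Q
    exact (ColimPre.homotopic_of_toFrac h).symm.toFrac
  trans {P Q R} h h' := by
    obtain ⟨p, rfl⟩ := ColimPre.exists_toFrac_eq (X := X.toColim) (Y := Y.toColim) P
    obtain ⟨q, rfl⟩ := ColimPre.exists_toFrac_eq (X := X.toColim) (Y := Y.toColim) Q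
    obtain ⟨r, rfl⟩ := ColimPre.exists_toFrac_eq (X := X.toColim) (Y := Y.toColim) R
    exact ((ColimPre.homotopic_of_toFrac h).trans hW
      (ColimPre.homotopic_of_toFrac h')).toFrac

theorem nonempty_square (hW : IsCofilteredBicat (WSlice W A)) (P : FracPre X Y)
    (Q : FracPre Y Z) : Nonempty (P.Square Q) := by
  obtain ⟨p, rfl⟩ := ColimPre.exists_toFrac_eq (X := X.toColim) (Y := Y.toColim) P
  obtain ⟨q, rfl⟩ := ColimPre.exists_toFrac_eq (X := Y.toColim) (Y := Z.toColim) Q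
  exact (ColimPre.nonempty_square hW p q).map ColimPre.Square.toFrac

theorem comp_homotopic_comp (hW : IsCofilteredBicat (WSlice W A)) (P : FracPre X Y)
    (Q : FracPre Y Z) (S S' : P.Square Q) : Homotopic (P.comp Q S) (P.comp Q S') := by
  obtain ⟨p, rfl⟩ := ColimPre.exists_toFrac_eq (X := X.toColim) (Y := Y.toColim) P
  obtain ⟨q, rfl⟩ := ColimPre.exists_toFrac_eq (X := Y.toColim) (Y := Z.toColim) Q
  obtain ⟨s, rfl⟩ := ColimPre.exists_square_toFrac_eq S
  obtain ⟨s', rfl⟩ := ColimPre.exists_square_toFrac_eq S'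
  have := (ColimPre.comp_homotopic_comp hW (.refl p) (.refl q) s s').toFrac
  rwa [ColimPre.toFrac_comp, ColimPre.toFrac_comp] at this

end FracPre

/-- The comparison of arrows, `[p] ↦ [p.toFrac]`. -/
def ColimHom.toFrac {X Y : ColimObj (homDiagram W A T)} :
    ColimHom X Y → FracHom X.toFrac Y.toFrac :=
  Quot.map ColimPre.toFrac fun _ _ h => h.toFrac

theorem ColimHom.toFrac_bijective (hW : IsCofilteredBicat (WSlice W A))
    {X Y : ColimObj (homDiagram W A T)} :
    Function.Bijective (ColimHom.toFrac (X := X) (Y := Y)) := by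
  constructor
  · intro f g h
    obtain ⟨p, rfl⟩ := Quot.exists_rep f
    obtain ⟨q, rfl⟩ := Quot.exists_rep g
    exact Quot.sound (ColimPre.homotopic_of_toFrac
      ((FracPre.homotopic_equivalence hW).eqvGen_iff.1 (Quot.eqvGen_exact h)))
  · intro f
    obtain ⟨P, rfl⟩ := Quot.exists_rep f
    obtain ⟨p, rfl⟩ := ColimPre.exists_toFrac_eq P
    exact ⟨Quot.mk _ p, rfl⟩

/-- The bijection between arrows of `Colim F` and arrows of the category of fractions. -/
noncomputable def fracHomEquiv (hW : IsCofilteredBicat (WSlice W A))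
    (X Y : ColimObj (homDiagram W A T)) : ColimHom X Y ≃ FracHom X.toFrac Y.toFrac :=
  Equiv.ofBijective _ (ColimHom.toFrac_bijective hW)

/-- Composition of homotopy classes of quintuples. -/
noncomputable def FracHom.comp (hW : IsCofilteredBicat (WSlice W A))
    {X Y Z : ColimObj (homDiagram W A T)} (f : FracHom X.toFrac Y.toFrac)
    (g : FracHom Y.toFrac Z.toFrac) : FracHom X.toFrac Z.toFrac :=
  ColimHom.toFrac (ColimHom.comp hW ((fracHomEquiv hW X Y).symm f) ((fracHomEquiv hW Y Z).symm g))

theorem ColimHom.toFrac_comp (hW : IsCofilteredBicat (WSlice W A))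
    {X Y Z : ColimObj (homDiagram W A T)} (f : ColimHom X Y) (g : ColimHom Y Z) :
    (ColimHom.comp hW f g).toFrac = FracHom.comp hW f.toFrac g.toFrac := by
  unfold FracHom.comp
  rw [show f.toFrac = fracHomEquiv hW X Y f from rfl, show g.toFrac = fracHomEquiv hW Y Z g from rfl,
    Equiv.symm_apply_apply, Equiv.symm_apply_apply]

theorem ColimPre.toFrac_id (X : ColimObj (homDiagram W A T)) :
    (ColimPre.id X).toFrac = FracPre.id X.toFrac := by
  have : (λ_ X.toFrac.w).symm.symm ≪≫ (λ_ X.toFrac.w).symm = Iso.refl _ := by simp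
  change FracPre.mk X.toFrac.apex (𝟙 _) (𝟙 _) ((λ_ X.toFrac.w).symm.symm ≪≫ (λ_ X.toFrac.w).symm)
    (𝟙 _) _ = _
  rw [this]
  rfl

/-- The category of fractions. -/
noncomputable def fracCategory (hW : IsCofilteredBicat (WSlice W A)) (T : B) :
    FracCategory W A T where
  comp {X Y Z} := FracHom.comp hW (X := X.toColim) (Y := Y.toColim) (Z := Z.toColim)
  comp_mk {X Y Z} P Q S := by
    obtain ⟨p, rfl⟩ := ColimPre.exists_toFrac_eq (X := X.toColim) (Y := Y.toColim) P
    obtain ⟨q, rfl⟩ := ColimPre.exists_toFrac_eq (X := Y.toColim) (Y := Z.toColim) Q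
    -- Every square of quintuples comes from a square of premorphisms, so the formula holds for all
    -- choices at once.
    obtain ⟨s, rfl⟩ := ColimPre.exists_square_toFrac_eq S
    refine (ColimHom.toFrac_comp hW (ColimHom.mk p) (ColimHom.mk q)).symm.trans ?_
    rw [ColimHom.comp_mk hW p q s]
    exact congrArg FracHom.mk (ColimPre.toFrac_comp p q s)
  id_comp {X Y} f := by
    obtain ⟨f, rfl⟩ := (ColimHom.toFrac_bijective hW (X := X.toColim) (Y := Y.toColim)).2 f
    have h := congrArg ColimHom.toFrac ((colimCategory _ hW).id_comp f)
    refine Eq.trans ?_ h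
    refine Eq.trans ?_ (ColimHom.toFrac_comp hW (ColimHom.mk (ColimPre.id X.toColim)) f).symm
    exact congrArg (fun t => FracHom.comp hW (FracHom.mk t) f.toFrac)
      (ColimPre.toFrac_id X.toColim).symm
  comp_id {X Y} f := by
    obtain ⟨f, rfl⟩ := (ColimHom.toFrac_bijective hW (X := X.toColim) (Y := Y.toColim)).2 f
    have h := congrArg ColimHom.toFrac ((colimCategory _ hW).comp_id f)
    refine Eq.trans ?_ h
    refine Eq.trans ?_ (ColimHom.toFrac_comp hW f (ColimHom.mk (ColimPre.id Y.toColim))).symm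
    exact congrArg (fun t => FracHom.comp hW f.toFrac (FracHom.mk t))
      (ColimPre.toFrac_id Y.toColim).symm
  assoc {X Y Z V} f g h := by
    obtain ⟨f, rfl⟩ := (ColimHom.toFrac_bijective hW (X := X.toColim) (Y := Y.toColim)).2 f
    obtain ⟨g, rfl⟩ := (ColimHom.toFrac_bijective hW (X := Y.toColim) (Y := Z.toColim)).2 g
    obtain ⟨h, rfl⟩ := (ColimHom.toFrac_bijective hW (X := Z.toColim) (Y := V.toColim)).2 h
    rw [← ColimHom.toFrac_comp, ← ColimHom.toFrac_comp, ← ColimHom.toFrac_comp,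
      ← ColimHom.toFrac_comp]
    exact congrArg ColimHom.toFrac ((colimCategory _ hW).assoc f g h)

/-- The comparison functor. -/
noncomputable def comparison (hW : IsCofilteredBicat (WSlice W A)) (T : B) :
    (colimCategory (homDiagram W A T) hW).Carrier ⥤ (fracCategory hW T).Carrier where
  obj X := ColimObj.toFrac X
  map f := ColimHom.toFrac f
  map_id X := congrArg FracHom.mk (ColimPre.toFrac_id X)
  map_comp f g := ColimHom.toFrac_comp hW f g

theorem comparison_isIso (hW : IsCofilteredBicat (WSlice W A)) (T : B) :
    IsIsoOfCategories (comparison hW T) :=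
  ⟨Function.bijective_iff_has_inverse.2 ⟨FracObj.toColim, fun _ => rfl, fun _ => rfl⟩,
    fun _ _ => ColimHom.toFrac_bijective hW⟩

end Comparison

end BicatFrac

theorem mainTheorem6 {B : Type u} [Bicategory.{w, v} B]
    (W : ∀ ⦃X Y : B⦄, (X ⟶ Y) → Prop) (A T : B)
    (hW : BicatFrac.IsCofilteredBicat (BicatFrac.WSlice W A)) :
    -- homotopy of premorphisms is an equivalence relation, and composition squares exist
    (∀ X Y : BicatFrac.ColimObj (BicatFrac.homDiagram W A T),
      Equivalence (BicatFrac.ColimPre.Homotopic (X := X) (Y := Y))) ∧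
    (∀ (X Y Z : BicatFrac.ColimObj (BicatFrac.homDiagram W A T))
      (p : BicatFrac.ColimPre X Y) (q : BicatFrac.ColimPre Y Z), Nonempty (p.Square q)) ∧
    -- the same for the quintuples of the bicategory of fractions
    (∀ X Y : BicatFrac.FracObj W A T,
      Equivalence (BicatFrac.FracPre.Homotopic (X := X) (Y := Y))) ∧
    (∀ (X Y Z : BicatFrac.FracObj W A T)
      (p : BicatFrac.FracPre X Y) (q : BicatFrac.FracPre Y Z), Nonempty (p.Square q)) ∧
    -- vertical composition is independent of the choice of squares
    (∀ (X Y Z : BicatFrac.FracObj W A T) (p : BicatFrac.FracPre X Y) (q : BicatFrac.FracPre Y Z)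
      (s s' : p.Square q), BicatFrac.FracPre.Homotopic (p.comp q s) (p.comp q s')) ∧
    -- both constructions give categories, the first one is the pseudo-colimit of the diagram,
    -- and the canonical assignment is an isomorphism between them
    ∃ (S : BicatFrac.ColimCategory (BicatFrac.homDiagram W A T))
      (R : BicatFrac.FracCategory W A T),
      (∃ θ : BicatFrac.CatCocone (BicatFrac.homDiagram W A T) S.Carrier,
        (∀ (j : (BicatFrac.WSlice W A)ᵒᵖ) (x : (BicatFrac.homDiagram W A T).obj j),
          (θ.leg j).obj x = (⟨j, x⟩ : BicatFrac.ColimObj (BicatFrac.homDiagram W A T))) ∧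
        BicatFrac.CatCocone.IsPseudoColimit.{vE, uE} θ) ∧
      ∃ H : S.Carrier ⥤ R.Carrier,
        BicatFrac.IsIsoOfCategories H ∧
        (∀ X : BicatFrac.ColimObj (BicatFrac.homDiagram W A T), H.obj X = X.toFrac) ∧
        ∀ (X Y : BicatFrac.ColimObj (BicatFrac.homDiagram W A T)) (p : BicatFrac.ColimPre X Y),
          HEq (H.map (X := X) (Y := Y) (BicatFrac.ColimHom.mk p))
            (BicatFrac.FracHom.mk p.toFrac) :=
  ⟨fun _ _ => BicatFrac.ColimPre.homotopic_equivalence hW,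
    fun _ _ _ => BicatFrac.ColimPre.nonempty_square hW,
    fun _ _ => BicatFrac.FracPre.homotopic_equivalence hW,
    fun _ _ _ => BicatFrac.FracPre.nonempty_square hW,
    fun _ _ _ => BicatFrac.FracPre.comp_homotopic_comp hW,
    BicatFrac.colimCategory _ hW, BicatFrac.fracCategory hW T,
    ⟨BicatFrac.colimCocone _ hW, fun _ _ => rfl, BicatFrac.colimCocone_isPseudoColimit⟩,
    BicatFrac.comparison hW T, BicatFrac.comparison_isIso hW T, fun _ => rfl,
    fun _ _ _ => HEq.rfl⟩
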